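/- Let $h$ be a centered Gaussian random variable (possibly degenerate) with $\mathbb{E}e^{2|h|}<1/\max_{b\ge 0}\frac{b}{\cosh^2 b}$. For a sequence $B=(\beta_p)_{p\ge 1}$ of reals with $\sum_{p\ge1}2^p\beta_p^2<\infty$ let, for $\sigma\in\{-1,1\}^N$, $$H_N^{SK}(\sigma)=\sum_{p\ge1}\frac{\beta_p}{N^{p-1/2}}\sum_{1\le i_1,\dots,i_{2p}\le N}g_{i_1,\dots,i_{2p}}\sigma_{i_1}\cdots\sigma_{i_{2p}}$$ with i.i.d. standard Gaussian $g_{i_1,\dots,i_{2p}}$. For a Gaussian random variable $k$ let $$F^{SK}(B,k)=\lim_{N\to\infty}\frac1N\,\mathbb{E}\ln\sum_{\sigma\in\{-1,1\}^N}\exp\Big(H_N^{SK}(\sigma)+\sum_{i\le N}k_i\sigma_i\Big),$$ where $k_1,\dots,k_N$ are i.i.d. copies of $k$, independent of the $g$'s. Put $\xi(x)=\sum_{p\ge1}\beta_p^2x^{2p}$, and for $\beta\ge0$ let $$\Omega(\beta,B,h)=\operatorname*{Argmax}_{\mu\in[-1,1]}\Big\{F^{SK}(B,\beta\mu+h)-\frac{\beta\mu^2}{2}\Big\}.$$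 Let $f(\mu,\beta)=F^{SK}(\mathbf 0,\beta\mu+h)-\beta\mu^2/2$, and let $\alpha$ be defined by $\alpha\,\mathbb{E}[1/\cosh^2h]=1$. For $\beta>\alpha$ let $\mu(\beta)\in(0,1)$ be the unique maximizer of $f(\cdot,\beta)$ over $[0,1]$. For $0<u<1$ let $\beta_u$ be the unique $\beta\in(\alpha,\infty)$ with $\mu(\beta)=u$, and let $\delta_u(\beta)=f(\mu(\beta),\beta)-f(u,\beta)$ for $\beta\ge\beta_u$. Let $\mathcal R_u$ be the set of all $(\beta,B)$ such that $\beta>0$, $\sum_{p\ge1}2^p\beta_p^2<\infty$, $\beta_p\ne0$ for all $p\ge1$, the set $\Omega(\beta,B,h)$ either consists of one point or equals $\{\mu,-\mu\}$ for some $0<\mu<1$, and moreover $\beta>\beta_u$ and $\xi(1)<2\delta_u(\beta)$. Then for every $0<u<1$ and every $(\beta,B)\in\mathcal R_u$, $$\Omega(\beta,B,h)\subset[-1,-u)\cup(u,1].$$ -/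

import Mathlib

open MeasureTheory ProbabilityTheory Filter Topology

noncomputable section

namespace SKFI

/-- The configuration space `{-1, +1}^N`. -/
abbrev Config (N : ℕ) : Type := Fin N → ℤˣ

/-- The `i`-th spin of a configuration, as a real number. -/
def spin {N : ℕ} (σ : Config N) (i : Fin N) : ℝ := ((σ i : ℤ) : ℝ)

/-- Index set of the SK couplings `g_{i_1, …, i_{2p}}`, `p ≥ 1`, `1 ≤ i_1, …, i_{2p} ≤ N`. -/
abbrev CouplingIndex (N : ℕ) : Type := Σ p : ℕ+, (Fin (2 * (p : ℕ)) → Fin N)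

/-- The law of the couplings: i.i.d. standard Gaussian random variables. -/
def couplingLaw (N : ℕ) : Measure (CouplingIndex N → ℝ) :=
  Measure.infinitePi fun _ : CouplingIndex N => gaussianReal 0 1

/-- The mixed even `p`-spin Hamiltonian
`∑_{p ≥ 1} (β_p / N^{p - 1/2}) ∑_{i_1, …, i_{2p}} g_{i_1, …, i_{2p}} σ_{i_1} ⋯ σ_{i_{2p}}`. -/
def hamiltonianSK {N : ℕ} (B : ℕ+ → ℝ) (g : CouplingIndex N → ℝ) (σ : Config N) : ℝ :=
  ∑' p : ℕ+, B p / (N : ℝ) ^ (((p : ℕ) : ℝ) - 1 / 2) *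
    ∑ i : Fin (2 * (p : ℕ)) → Fin N, g ⟨p, i⟩ * ∏ k, spin σ (i k)

/-- The partition function of the SK model with couplings `g` and external fields `(h_i)_{i ≤ N}`. -/
def partitionSK {N : ℕ} (B : ℕ+ → ℝ) (g : CouplingIndex N → ℝ) (h : Fin N → ℝ) : ℝ :=
  ∑ σ : Config N, Real.exp (hamiltonianSK B g σ + ∑ i, h i * spin σ i)

/-- The finite volume free energy `N⁻¹ 𝔼 ln Z_N` of the SK model: the couplings are i.i.d.
standard Gaussian and, independently of them, the fields `h_i` are i.i.d. with law `ν`. -/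
def finiteFreeEnergySK (N : ℕ) (B : ℕ+ → ℝ) (ν : Measure ℝ) : ℝ :=
  (N : ℝ)⁻¹ * ∫ w : (CouplingIndex N → ℝ) × (Fin N → ℝ), Real.log (partitionSK B w.1 w.2)
    ∂((couplingLaw N).prod (Measure.pi fun _ : Fin N => ν))

/-- The thermodynamic limit of the free energy of the SK model, for an external field of law `ν`. -/
def freeEnergySK (B : ℕ+ → ℝ) (ν : Measure ℝ) : ℝ :=
  limUnder atTop fun N : ℕ => finiteFreeEnergySK N B ν

/-- The function `μ ↦ F^{SK}(B, β μ + h) - β μ² / 2`, where `ν` is the law of `h`. -/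
def variational (ν : Measure ℝ) (β : ℝ) (B : ℕ+ → ℝ) (μ : ℝ) : ℝ :=
  freeEnergySK B (ν.map fun x => β * μ + x) - β * μ ^ 2 / 2

/-- The set `Ω(β, B, h)` of maximizers over `[-1, 1]`, where `ν` is the law of `h`. -/
def argmaxSet (ν : Measure ℝ) (β : ℝ) (B : ℕ+ → ℝ) : Set ℝ :=
  {μ | μ ∈ Set.Icc (-1 : ℝ) 1 ∧ IsMaxOn (variational ν β B) (Set.Icc (-1 : ℝ) 1) μ}

/-- The space of temperature parameters `(β, (β_p)_{p ≥ 1})`. -/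
def temperatures : Set (ℝ × (ℕ+ → ℝ)) :=
  {q | 0 ≤ q.1 ∧ Summable fun p : ℕ+ => (2 : ℝ) ^ (p : ℕ) * q.2 p ^ 2}

/-- The parameters with `β > 0` for which `Ω` is a singleton or `{μ, -μ}` with `0 < μ < 1`. -/
def temperaturesD (ν : Measure ℝ) : Set (ℝ × (ℕ+ → ℝ)) :=
  {q | q ∈ temperatures ∧ 0 < q.1 ∧
    ((∃ μ : ℝ, argmaxSet ν q.1 q.2 = {μ}) ∨
      ∃ μ : ℝ, 0 < μ ∧ μ < 1 ∧ argmaxSet ν q.1 q.2 = {μ, -μ})}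

/-- The parameters as above for which, in addition, `β_p ≠ 0` for all `p ≥ 1`. -/
def temperaturesD' (ν : Measure ℝ) : Set (ℝ × (ℕ+ → ℝ)) :=
  {q | q ∈ temperaturesD ν ∧ ∀ p : ℕ+, q.2 p ≠ 0}

/-- `ξ(x) = ∑_{p ≥ 1} β_p² x^{2p}`. -/
def xi (B : ℕ+ → ℝ) (x : ℝ) : ℝ := ∑' p : ℕ+, B p ^ 2 * x ^ (2 * (p : ℕ))

/-- The Curie-Weiss function `f(μ, β) = F^{SK}(0, β μ + h) - β μ² / 2`. -/
def cwFun (ν : Measure ℝ) (μ β : ℝ) : ℝ := variational ν β 0 μ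

/-- The number `α` with `α 𝔼[1 / cosh² h] = 1`. -/
def cwAlpha (ν : Measure ℝ) : ℝ := (∫ x, 1 / Real.cosh x ^ 2 ∂ν)⁻¹

/-- `μ(β)`: the maximizer of `f(·, β)` over `[0, 1]` (it is unique for `β > α`). -/
def cwMag (ν : Measure ℝ) (β : ℝ) : ℝ :=
  Classical.epsilon fun μ : ℝ =>
    μ ∈ Set.Icc (0 : ℝ) 1 ∧ IsMaxOn (fun μ' => cwFun ν μ' β) (Set.Icc (0 : ℝ) 1) μ

/-- `β_u`: the unique `β ∈ (α, ∞)` with `μ(β) = u`. -/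
def betaU (ν : Measure ℝ) (u : ℝ) : ℝ :=
  Classical.epsilon fun β : ℝ => cwAlpha ν < β ∧ cwMag ν β = u

/-- `δ_u(β) = f(μ(β), β) - f(u, β)`. -/
def deltaU (ν : Measure ℝ) (u β : ℝ) : ℝ := cwFun ν (cwMag ν β) β - cwFun ν u β

/-- The temperature region `R_u`. -/
def regionU (ν : Measure ℝ) (u : ℝ) : Set (ℝ × (ℕ+ → ℝ)) :=
  {q | q ∈ temperaturesD' ν ∧ betaU ν u < q.1 ∧ xi q.2 1 < 2 * deltaU ν u q.1}

end SKFI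

end

/-! The theorem is a perturbation of the Curie-Weiss model. Turning on the couplings can only raise
the free energy, and by at most `ξ(1)/2`: for every field law with finite mean, `F(0,k) ≤ F(B,k) ≤
F(0,k) + ξ(1)/2` (`SKFI.freeEnergySK_bounds`). Both inequalities are Jensen's: the lower one holds
because the Hamiltonian has mean zero, the upper one is the annealed bound with variance `N ξ(1)` at
each configuration. So the functional being maximized lies between `f(·, β)` and `f(·, β) + ξ(1)/2`.

If some maximizer `q` had `|q| ≤ u`, comparing it with the Curie-Weiss magnetization `μ(β)` would
give `f(μ(β), β) ≤ f(q, β) + ξ(1)/2`. Since `f` is even in its first argument and, for `β > β_u`,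
nondecreasing on `[0, u]` (`SKFI.cwFun_le_of_betaU_lt`), the right side is at most `f(u, β) +
ξ(1)/2`. That means `δ_u(β) ≤ ξ(1)/2`, against the definition of the region.

Two points take work. The free energy is a limit in `N`, so finite-volume bounds pass to it only
once the limit exists. This is Guerra-Toninelli superadditivity plus Fekete's lemma: `ξ` is convex,
so cutting the system into two independent blocks raises the covariances at equal variances, and a
Gaussian comparison inequality (`integral_logSumExp_anti`) lowers the mean log partition function.
The Hamiltonian is an infinite series, so its Gaussian law is identified through characteristic
functions.

On the Curie-Weiss side, `f' = β (𝔼 tanh(βμ + h) - μ)`. The average `x ↦ 𝔼 tanh(x + h)` is strictly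
concave on `[0, ∞)` and vanishes at `0`, so its ratio to `x` decreases; this determines the sign of
`f'` on either side of a fixed point. -/

/-! ### Gaussian integration by parts. -/

/-- Gaussian integration by parts on the real line. -/
theorem integral_mul_gaussianReal_eq_integral_deriv {F F' : ℝ → ℝ}
    (hF : ∀ x, HasDerivAt F (F' x) x) {C C' : ℝ} (hC : ∀ x, |F x| ≤ C) (hC' : ∀ x, |F' x| ≤ C') :
    ∫ x, x * F x ∂gaussianReal 0 1 = ∫ x, F' x ∂gaussianReal 0 1 := by
  have hF'_eq : F' = deriv F := funext fun x => (hF x).deriv.symm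
  have hmF : Measurable F :=
    (continuous_iff_continuousAt.2 fun x => (hF x).continuousAt).measurable
  have hmF' : Measurable F' := hF'_eq ▸ measurable_deriv F
  have hpdf : ∀ x, gaussianPDFReal 0 1 x = (√(2 * Real.pi))⁻¹ * Real.exp (-(1 / 2) * x ^ 2) := by
    intro x
    simp only [gaussianPDFReal, sub_zero, NNReal.coe_one, mul_one]
    congr 2
    ring
  have hd : ∀ x, HasDerivAt (gaussianPDFReal 0 1) (-x * gaussianPDFReal 0 1 x) x := by
    intro x
    have h1 : HasDerivAt (fun x : ℝ => (√(2 * Real.pi))⁻¹ * Real.exp (-(1 / 2) * x ^ 2))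
        ((√(2 * Real.pi))⁻¹ * (Real.exp (-(1 / 2) * x ^ 2) * (-(1 / 2) * (2 * x)))) x := by
      have := ((((hasDerivAt_pow 2 x).const_mul (-(1 / 2 : ℝ))).exp).const_mul
        (√(2 * Real.pi))⁻¹)
      simpa using this
    rw [funext hpdf]
    convert h1 using 1
    ring
  have hi1 : Integrable (gaussianPDFReal 0 1) := integrable_gaussianPDFReal 0 1
  have hi2 : Integrable fun x => -x * gaussianPDFReal 0 1 x := by
    have := ((integrable_mul_exp_neg_mul_sq (b := 1 / 2) (by norm_num)).const_mul
      (-(√(2 * Real.pi))⁻¹))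
    refine this.congr (ae_of_all _ fun x => ?_)
    simp only [hpdf]
    ring
  have key := integral_mul_deriv_eq_deriv_mul_of_integrable (u := F) (v := gaussianPDFReal 0 1)
    (u' := F') (v' := fun x => -x * gaussianPDFReal 0 1 x) (fun x _ => hF x) (fun x _ => hd x)
    (hi2.bdd_mul hmF.aestronglyMeasurable (ae_of_all _ hC))
    (hi1.bdd_mul hmF'.aestronglyMeasurable (ae_of_all _ hC'))
    (hi1.bdd_mul hmF.aestronglyMeasurable (ae_of_all _ hC))
  rw [integral_gaussianReal_eq_integral_smul one_ne_zero,
    integral_gaussianReal_eq_integral_smul one_ne_zero]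
  simp only [smul_eq_mul]
  have e1 : ∀ x, gaussianPDFReal 0 1 x * (x * F x) = -(F x * (-x * gaussianPDFReal 0 1 x)) :=
    fun x => by ring
  have e2 : ∀ x, gaussianPDFReal 0 1 x * F' x = F' x * gaussianPDFReal 0 1 x :=
    fun x => by ring
  simp only [e1, e2, integral_neg, key, neg_neg]

/-- Resampling one coordinate preserves a product measure. -/
theorem measurePreserving_update_pi {ι : Type*} [Fintype ι] [DecidableEq ι] (γ : Measure ℝ)
    [IsProbabilityMeasure γ] (k : ι) :
    MeasurePreserving (fun p : (ι → ℝ) × ℝ => Function.update p.1 k p.2)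
      ((Measure.pi fun _ : ι => γ).prod γ) (Measure.pi fun _ : ι => γ) where
  measurable := by fun_prop
  map_eq := by
    refine (Measure.pi_eq fun s hs => ?_).symm
    rw [Measure.map_apply (by fun_prop) (MeasurableSet.univ_pi hs)]
    have : (fun p : (ι → ℝ) × ℝ => Function.update p.1 k p.2) ⁻¹' Set.pi Set.univ s
        = (Set.pi Set.univ (Function.update s k Set.univ)) ×ˢ s k := by
      ext p
      simp only [Set.mem_preimage, Set.mem_pi, Set.mem_univ, true_imp_iff, Set.mem_prod]
      constructor
      · intro h
        refine ⟨fun i => ?_, by simpa using h k⟩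
        by_cases hi : i = k
        · subst hi; simp
        · simpa [hi] using h i
      · rintro ⟨h1, h2⟩ i
        by_cases hi : i = k
        · subst hi; simpa using h2
        · simpa [hi] using h1 i
    rw [this, Measure.prod_prod, Measure.pi_pi,
      ← Finset.mul_prod_erase Finset.univ (fun i => γ (s i)) (Finset.mem_univ k),
      ← Finset.mul_prod_erase Finset.univ _ (Finset.mem_univ k)]
    simp only [Function.update_self, measure_univ, one_mul]
    rw [mul_comm]
    congr 1
    refine Finset.prod_congr rfl fun i hi => ?_
    rw [Function.update_of_ne (Finset.ne_of_mem_erase hi)]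

/-- Gaussian integration by parts for i.i.d. standard Gaussian coordinates. -/
theorem integral_eval_mul_pi_gaussianReal {ι : Type*} [Fintype ι] [DecidableEq ι] (k : ι)
    {F F' : (ι → ℝ) → ℝ} (hFm : Continuous F) (hFm' : Continuous F')
    (hF : ∀ x t, HasDerivAt (fun t => F (Function.update x k t)) (F' (Function.update x k t)) t)
    {C C' : ℝ} (hC : ∀ x, |F x| ≤ C) (hC' : ∀ x, |F' x| ≤ C') :
    ∫ x, x k * F x ∂(Measure.pi fun _ : ι => gaussianReal 0 1)
      = ∫ x, F' x ∂(Measure.pi fun _ : ι => gaussianReal 0 1) := by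
  have hmp := measurePreserving_update_pi (gaussianReal 0 1) k
  have hi1 : Integrable (fun x : ι → ℝ => x k * F x)
      (Measure.pi fun _ : ι => gaussianReal 0 1) := by
    have h0 : Integrable (fun x : ι → ℝ => x k) (Measure.pi fun _ : ι => gaussianReal 0 1) :=
      integrable_eval (i := k) IsGaussian.integrable_id
    simpa [mul_comm] using h0.bdd_mul hFm.aestronglyMeasurable (ae_of_all _ hC)
  have hi2 : Integrable F' (Measure.pi fun _ : ι => gaussianReal 0 1) :=
    Integrable.of_bound hFm'.aestronglyMeasurable C' (ae_of_all _ hC')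
  -- Resampling coordinate `k` makes it an independent variable, so Fubini reduces the claim to the
  -- one-dimensional formula with the other coordinates frozen.
  rw [← hmp.map_eq] at hi1 hi2 ⊢
  rw [integral_map hmp.measurable.aemeasurable hi1.1,
    integral_map hmp.measurable.aemeasurable hi2.1]
  rw [integrable_map_measure hi1.1 hmp.measurable.aemeasurable] at hi1
  rw [integrable_map_measure hi2.1 hmp.measurable.aemeasurable] at hi2
  refine (integral_prod _ hi1).trans (Eq.trans ?_ (integral_prod _ hi2).symm)
  refine integral_congr_ae (ae_of_all _ fun x => ?_)
  simp only [Function.comp_apply, Function.update_self]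
  exact integral_mul_gaussianReal_eq_integral_deriv (hF x) (fun _ => hC _) (fun _ => hC' _)

open scoped MatrixOrder in
/-- Gaussian integration by parts for a centered Gaussian vector. -/
theorem integral_eval_mul_multivariateGaussian {ι : Type*} [Fintype ι] [DecidableEq ι]
    {S : Matrix ι ι ℝ} (hS : S.PosSemidef) (i : ι) {F : EuclideanSpace ℝ ι → ℝ}
    {D : ι → EuclideanSpace ℝ ι → ℝ}
    (hF : ∀ x, HasFDerivAt F (∑ j, D j x • EuclideanSpace.proj (𝕜 := ℝ) j) x)
    (hD : ∀ j, Continuous (D j)) {C C' : ℝ} (hC : ∀ x, |F x| ≤ C) (hC' : ∀ j x, |D j x| ≤ C') :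
    ∫ x, x i * F x ∂multivariateGaussian 0 S
      = ∑ j, S i j * ∫ x, D j x ∂multivariateGaussian 0 S := by
  -- The vector is realized as `A z` with `z` standard and `A` the symmetric square root of `S`; the
  -- two factors of `A`, one from `x i` and one from the chain rule, recombine into `S`. No
  -- invertibility is needed.
  set A := CFC.sqrt S with hA
  have hAA : A * A = S := CFC.sqrt_mul_sqrt_self _ hS.nonneg
  have hAs : ∀ k l, A k l = A l k := by
    intro k l
    have : IsSelfAdjoint A := (CFC.sqrt_nonneg S).isSelfAdjoint
    have h := congrFun (congrFun this.star_eq l) k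
    simpa [Matrix.star_apply] using h
  have hFc : Continuous F := continuous_iff_continuousAt.2 fun x => (hF x).continuousAt
  let T : (ι → ℝ) → EuclideanSpace ℝ ι := fun z => WithLp.toLp 2 (A.mulVec z)
  have hTc : Continuous T := by
    refine (PiLp.continuous_toLp 2 _).comp ?_
    exact Continuous.matrix_mulVec continuous_const continuous_id
  have hlaw : multivariateGaussian 0 S = (Measure.pi fun _ : ι => gaussianReal 0 1).map T := by
    rw [multivariateGaussian, ← map_pi_eq_stdGaussian, Measure.map_map (by fun_prop) (by fun_prop)]
    congr 1
    ext z j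
    simp [T, hA, Matrix.toEuclideanCLM_toLp]
  have hT : ∀ z j, T z j = ∑ k, A j k * z k := fun z j => rfl
  rw [hlaw, integral_map hTc.measurable.aemeasurable
    (by exact (Continuous.mul (by fun_prop) hFc).aestronglyMeasurable)]
  simp_rw [integral_map hTc.measurable.aemeasurable (hD _).aestronglyMeasurable, hT,
    Finset.sum_mul, mul_assoc]
  have hint : ∀ k, Integrable (fun z : ι → ℝ => z k * F (T z))
      (Measure.pi fun _ : ι => gaussianReal 0 1) := by
    intro k
    have h0 : Integrable (fun x : ι → ℝ => x k) (Measure.pi fun _ : ι => gaussianReal 0 1) :=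
      integrable_eval (i := k) IsGaussian.integrable_id
    simpa [mul_comm] using h0.bdd_mul (hFc.comp hTc).aestronglyMeasurable
      (ae_of_all _ fun z => hC (T z))
  have hDint : ∀ j, Integrable (fun z => D j (T z)) (Measure.pi fun _ : ι => gaussianReal 0 1) :=
    fun j => Integrable.of_bound ((hD j).comp hTc).aestronglyMeasurable C'
      (ae_of_all _ fun z => hC' j (T z))
  rw [integral_finsetSum _ fun k _ => (hint k).const_mul _]
  simp_rw [integral_const_mul]
  have hT' : ∀ x k t, HasDerivAt (fun t => T (Function.update x k t))
      (WithLp.toLp 2 (fun j => A j k)) t := by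
    intro x k t
    have h1 : HasDerivAt (fun t => A.mulVec (Function.update x k t)) (fun j => A j k) t := by
      rw [hasDerivAt_pi]
      intro j
      have : ∀ l, HasDerivAt (fun t => A j l * Function.update x k t l)
          (A j l * (Pi.single k (1 : ℝ) : ι → ℝ) l) t := fun l =>
        (((hasDerivAt_pi.1 (hasDerivAt_update x k t)) l)).const_mul _
      have := HasDerivAt.fun_sum (u := Finset.univ) fun l _ => this l
      simpa [Matrix.mulVec, dotProduct, Pi.single_apply] using this
    exact (PiLp.hasFDerivAt_toLp (𝕜 := ℝ) 2 _).comp_hasDerivAt t h1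
  have hstein : ∀ k, ∫ z, z k * F (T z) ∂(Measure.pi fun _ : ι => gaussianReal 0 1)
      = ∑ j, A j k * ∫ z, D j (T z) ∂(Measure.pi fun _ : ι => gaussianReal 0 1) := by
    intro k
    rw [integral_eval_mul_pi_gaussianReal k (F := fun z => F (T z))
      (F' := fun z => ∑ j, D j (T z) * A j k) (hFc.comp hTc)
      (continuous_finsetSum _ fun j _ => ((hD j).comp hTc).mul continuous_const) ?_
      (fun z => hC _) (C' := ∑ j, C' * |A j k|) ?_]
    · rw [integral_finsetSum _ fun j _ => (hDint j).mul_const _]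
      simp_rw [integral_mul_const, mul_comm]
    · intro x t
      have := (hF (T (Function.update x k t))).comp_hasDerivAt t (hT' x k t)
      refine this.congr_deriv ?_
      simp
    · intro z
      refine (Finset.abs_sum_le_sum_abs _ _).trans (Finset.sum_le_sum fun j _ => ?_)
      rw [abs_mul]
      exact mul_le_mul_of_nonneg_right (hC' j _) (abs_nonneg _)
  simp_rw [hstein, Finset.mul_sum, ← hAA, Matrix.mul_apply, Finset.sum_mul]
  rw [Finset.sum_comm]
  refine Finset.sum_congr rfl fun j _ => Finset.sum_congr rfl fun k _ => ?_
  rw [hAs j k, mul_assoc]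

/-! ### Log-sum-exp of a Gaussian vector and the comparison inequality. -/

section LogSumExp

variable {ι : Type*} [Fintype ι]

/-- The function `x ↦ log ∑ᵢ exp (xᵢ + aᵢ)`. -/
noncomputable def logSumExp (a : ι → ℝ) (x : EuclideanSpace ℝ ι) : ℝ :=
  Real.log (∑ i, Real.exp (x i + a i))

/-- The Gibbs weights `exp (xᵢ + aᵢ) / ∑ⱼ exp (xⱼ + aⱼ)`. -/
noncomputable def softmax (a : ι → ℝ) (i : ι) (x : EuclideanSpace ℝ ι) : ℝ :=
  Real.exp (x i + a i) / ∑ j, Real.exp (x j + a j)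

theorem softmax_nonneg (a : ι → ℝ) (i : ι) (x : EuclideanSpace ℝ ι) : 0 ≤ softmax a i x := by
  unfold softmax
  positivity

theorem sum_exp_pos [Nonempty ι] (f : ι → ℝ) : 0 < ∑ i, Real.exp (f i) :=
  Finset.sum_pos (fun _ _ => Real.exp_pos _) Finset.univ_nonempty

theorem softmax_le_one (a : ι → ℝ) (i : ι) (x : EuclideanSpace ℝ ι) : softmax a i x ≤ 1 := by
  refine div_le_one_of_le₀ ?_ (by positivity)
  exact Finset.single_le_sum (f := fun j => Real.exp (x j + a j))
    (fun j _ => (Real.exp_pos _).le) (Finset.mem_univ i)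

theorem hasFDerivAt_exp_eval_add (a : ι → ℝ) (i : ι) (x : EuclideanSpace ℝ ι) :
    HasFDerivAt (fun x : EuclideanSpace ℝ ι => Real.exp (x i + a i))
      (Real.exp (x i + a i) • EuclideanSpace.proj (𝕜 := ℝ) i) x :=
  (((EuclideanSpace.proj (𝕜 := ℝ) i : EuclideanSpace ℝ ι →L[ℝ] ℝ).hasFDerivAt
    (x := x)).add_const (a i)).exp

theorem hasFDerivAt_logSumExp [Nonempty ι] (a : ι → ℝ) (x : EuclideanSpace ℝ ι) :
    HasFDerivAt (logSumExp a) (∑ j, softmax a j x • EuclideanSpace.proj (𝕜 := ℝ) j) x := by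
  have h := (HasFDerivAt.fun_sum (u := Finset.univ)
    fun i _ => hasFDerivAt_exp_eval_add a i x).log (sum_exp_pos _).ne'
  refine h.congr_fderiv ?_
  rw [Finset.smul_sum]
  refine Finset.sum_congr rfl fun j _ => ?_
  rw [smul_smul, softmax, div_eq_inv_mul]

theorem hasFDerivAt_softmax [Nonempty ι] [DecidableEq ι] (a : ι → ℝ) (i : ι)
    (x : EuclideanSpace ℝ ι) :
    HasFDerivAt (softmax a i) (∑ j, (softmax a i x * ((if i = j then 1 else 0) - softmax a j x)) •
      EuclideanSpace.proj (𝕜 := ℝ) j) x := by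
  have h2 := ((EuclideanSpace.proj (𝕜 := ℝ) i : EuclideanSpace ℝ ι →L[ℝ] ℝ).hasFDerivAt
    (x := x)).add_const (a i)
  -- Written as a single exponential, the Gibbs weight is differentiated from the known gradient of
  -- `logSumExp`, with no quotient rule.
  have heq : softmax a i = fun x => Real.exp ((x i + a i) - logSumExp a x) := by
    ext x
    rw [Real.exp_sub, logSumExp, Real.exp_log (sum_exp_pos _), softmax]
  have h := (h2.sub (hasFDerivAt_logSumExp a x)).exp
  have hab : ∀ r : ℝ, r • ((EuclideanSpace.proj (𝕜 := ℝ) i : EuclideanSpace ℝ ι →L[ℝ] ℝ)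
      - ∑ j, softmax a j x • EuclideanSpace.proj (𝕜 := ℝ) j) =
      ∑ j, (r * ((if i = j then 1 else 0) - softmax a j x)) • EuclideanSpace.proj (𝕜 := ℝ) j := by
    intro r
    ext v
    simp [mul_sub, sub_mul, Finset.mul_sum, mul_assoc, mul_ite, ite_mul]
  refine HasFDerivAt.congr_fderiv ?_ (hab (softmax a i x))
  rw [heq]
  exact h

theorem continuous_logSumExp [Nonempty ι] (a : ι → ℝ) : Continuous (logSumExp a) :=
  continuous_iff_continuousAt.2 fun x => (hasFDerivAt_logSumExp a x).continuousAt

theorem continuous_softmax [Nonempty ι] (a : ι → ℝ) (i : ι) : Continuous (softmax a i) := by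
  classical
  exact continuous_iff_continuousAt.2 fun x => (hasFDerivAt_softmax a i x).continuousAt

/-- If the exponents of two exponential sums differ by at most `c`, so do the logarithms. -/
theorem log_sum_exp_le_add [Nonempty ι] {f g : ι → ℝ} {c : ℝ} (h : ∀ i, f i ≤ g i + c) :
    Real.log (∑ i, Real.exp (f i)) ≤ Real.log (∑ i, Real.exp (g i)) + c := by
  have hc : c = Real.log (Real.exp c) := (Real.log_exp c).symm
  rw [show Real.log (∑ i, Real.exp (g i)) + c = Real.log (∑ i, Real.exp (g i)) +
    Real.log (Real.exp c) by rw [← hc], ← Real.log_mul (sum_exp_pos _).ne' (Real.exp_pos _).ne', Finset.sum_mul]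
  refine Real.log_le_log (sum_exp_pos _) (Finset.sum_le_sum fun i _ => ?_)
  rw [← Real.exp_add]
  exact Real.exp_le_exp.2 (h i)

theorem abs_logSumExp_le [Nonempty ι] (a : ι → ℝ) (x : EuclideanSpace ℝ ι) :
    |logSumExp a x| ≤ |Real.log (∑ i, Real.exp (a i))| + ∑ i, |x i| := by
  have hle : ∀ i, |x i| ≤ ∑ i, |x i| := fun i =>
    Finset.single_le_sum (f := fun i => |x i|) (fun _ _ => abs_nonneg _) (Finset.mem_univ i)
  have h1 : logSumExp a x ≤ Real.log (∑ i, Real.exp (a i)) + ∑ i, |x i| :=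
    log_sum_exp_le_add fun i => by linarith [hle i, le_abs_self (x i)]
  have h2 : Real.log (∑ i, Real.exp (a i)) ≤ logSumExp a x + ∑ i, |x i| :=
    log_sum_exp_le_add fun i => by linarith [hle i, neg_abs_le (x i)]
  rw [abs_le]
  constructor
  · linarith [neg_abs_le (Real.log (∑ i, Real.exp (a i)))]
  · linarith [le_abs_self (Real.log (∑ i, Real.exp (a i)))]

theorem integrable_eval_multivariateGaussian [DecidableEq ι] (S : Matrix ι ι ℝ) (i : ι) :
    Integrable (fun x : EuclideanSpace ℝ ι => x i) (multivariateGaussian 0 S) :=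
  ((EuclideanSpace.proj (𝕜 := ℝ) i : EuclideanSpace ℝ ι →L[ℝ] ℝ)).integrable_comp
    IsGaussian.integrable_fun_id

theorem integrable_logSumExp [Nonempty ι] [DecidableEq ι] (a : ι → ℝ) (S : Matrix ι ι ℝ) :
    Integrable (logSumExp a) (multivariateGaussian 0 S) := by
  refine Integrable.mono' (g := fun x => |Real.log (∑ i, Real.exp (a i))| + ∑ i, |x i|)
    ((integrable_const _).add (integrable_finsetSum _ fun i _ =>
      (integrable_eval_multivariateGaussian S i).abs))
    (continuous_logSumExp a).aestronglyMeasurable (ae_of_all _ fun x => abs_logSumExp_le a x)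

/-- A Gaussian comparison inequality: for two centered Gaussian vectors with the same variances,
the mean of the logarithm of an exponential sum decreases with the covariances. -/
theorem integral_logSumExp_anti [Nonempty ι] [DecidableEq ι] (a : ι → ℝ) {S S' : Matrix ι ι ℝ}
    (hS : S.PosSemidef) (hS' : S'.PosSemidef) (hdiag : ∀ i, S i i = S' i i)
    (hle : ∀ i j, S i j ≤ S' i j) :
    ∫ x, logSumExp a x ∂multivariateGaussian 0 S' ≤
      ∫ x, logSumExp a x ∂multivariateGaussian 0 S := by
  set ν := multivariateGaussian (0 : EuclideanSpace ℝ ι) S with hν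
  set ν' := multivariateGaussian (0 : EuclideanSpace ℝ ι) S' with hν'
  -- Interpolation between independent copies by a rotation, from `S` at `s = 0` to `S'` at `s =
  -- π/2`. Trigonometric weights avoid the endpoint singularities of `√t` and `√(1 - t)`.
  let Z : ℝ → EuclideanSpace ℝ ι × EuclideanSpace ℝ ι → EuclideanSpace ℝ ι := fun s p => Real.cos s • p.1 + Real.sin s • p.2
  have hZc : ∀ s, Continuous (Z s) := fun s => by fun_prop
  have hZa : ∀ s p i, Z s p i = Real.cos s * p.1 i + Real.sin s * p.2 i := by
    intro s p i; simp [Z]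
  have hi1 : ∀ i, Integrable (fun p : EuclideanSpace ℝ ι × EuclideanSpace ℝ ι => p.1 i) (ν.prod ν') := fun i =>
    (integrable_eval_multivariateGaussian S i).comp_fst ν'
  have hi2 : ∀ i, Integrable (fun p : EuclideanSpace ℝ ι × EuclideanSpace ℝ ι => p.2 i) (ν.prod ν') := fun i =>
    (integrable_eval_multivariateGaussian S' i).comp_snd ν
  let bound : EuclideanSpace ℝ ι × EuclideanSpace ℝ ι → ℝ := fun p => ∑ i, (|p.1 i| + |p.2 i|)
  have hbound : Integrable bound (ν.prod ν') :=
    integrable_finsetSum _ fun i _ => (hi1 i).abs.add (hi2 i).abs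
  let φ : ℝ → ℝ := fun s => ∫ p, logSumExp a (Z s p) ∂ν.prod ν'
  let φ' : ℝ → EuclideanSpace ℝ ι × EuclideanSpace ℝ ι → ℝ := fun s p =>
    ∑ i, softmax a i (Z s p) * (-Real.sin s * p.1 i + Real.cos s * p.2 i)
  have hcs : ∀ s (x y : ℝ), |-Real.sin s * x + Real.cos s * y| ≤ |x| + |y| := by
    intro s x y
    refine (abs_add_le _ _).trans (add_le_add ?_ ?_)
    · rw [abs_mul, abs_neg]
      exact mul_le_of_le_one_left (abs_nonneg _) (Real.abs_sin_le_one s)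
    · rw [abs_mul]
      exact mul_le_of_le_one_left (abs_nonneg _) (Real.abs_cos_le_one s)
  have hcs' : ∀ s (x y : ℝ), |Real.cos s * x + Real.sin s * y| ≤ |x| + |y| := by
    intro s x y
    refine (abs_add_le _ _).trans (add_le_add ?_ ?_)
    · rw [abs_mul]
      exact mul_le_of_le_one_left (abs_nonneg _) (Real.abs_cos_le_one s)
    · rw [abs_mul]
      exact mul_le_of_le_one_left (abs_nonneg _) (Real.abs_sin_le_one s)
  have hφ'm : ∀ s, Continuous (φ' s) := by
    intro s
    refine continuous_finsetSum _ fun i _ => ((continuous_softmax a i).comp (hZc s)).mul ?_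
    fun_prop
  have hφd : ∀ s, HasDerivAt φ (∫ p, φ' s p ∂ν.prod ν') s := by
    intro s
    refine (hasDerivAt_integral_of_dominated_loc_of_deriv_le (F := fun s p => logSumExp a (Z s p))
      (F' := φ') (bound := bound) Filter.univ_mem
      (Eventually.of_forall fun s =>
        ((continuous_logSumExp a).comp (hZc s)).aestronglyMeasurable)
      ?_ (hφ'm s).aestronglyMeasurable (ae_of_all _ fun p s _ => ?_) hbound
      (ae_of_all _ fun p s _ => ?_)).2
    · refine Integrable.mono' ((integrable_const |Real.log (∑ i, Real.exp (a i))|).add hbound)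
        ((continuous_logSumExp a).comp (hZc s)).aestronglyMeasurable (ae_of_all _ fun p => ?_)
      refine (abs_logSumExp_le a _).trans (add_le_add le_rfl (Finset.sum_le_sum fun i _ => ?_))
      rw [hZa]
      exact hcs' _ _ _
    · refine (Finset.abs_sum_le_sum_abs _ _).trans (Finset.sum_le_sum fun i _ => ?_)
      rw [abs_mul, abs_of_nonneg (softmax_nonneg a i _)]
      exact (mul_le_of_le_one_left (abs_nonneg _) (softmax_le_one a i _)).trans (hcs _ _ _)
    · have h1 : HasDerivAt (fun s => Z s p) (-Real.sin s • p.1 + Real.cos s • p.2) s :=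
        ((Real.hasDerivAt_cos s).smul_const p.1).add ((Real.hasDerivAt_sin s).smul_const p.2)
      refine ((hasFDerivAt_logSumExp a (Z s p)).comp_hasDerivAt s h1).congr_deriv ?_
      simp [φ']
  let G : ℝ → ι → ι → ℝ := fun s i j => ∫ p, softmax a i (Z s p) *
    ((if i = j then 1 else 0) - softmax a j (Z s p)) ∂ν.prod ν'
  let D : ι → ι → EuclideanSpace ℝ ι → ℝ := fun i j x => softmax a i x * ((if i = j then 1 else 0) - softmax a j x)
  have hDc : ∀ i j, Continuous (D i j) := fun i j =>
    (continuous_softmax a i).mul (continuous_const.sub (continuous_softmax a j))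
  have hDb : ∀ i j x, |D i j x| ≤ 1 := by
    intro i j x
    rw [abs_mul, abs_of_nonneg (softmax_nonneg a i x)]
    refine mul_le_one₀ (softmax_le_one a i x) (abs_nonneg _) ?_
    have h1 := softmax_nonneg a j x
    have h2 := softmax_le_one a j x
    rw [abs_le]
    split_ifs <;> constructor <;> linarith
  have hsb : ∀ i x, |softmax a i x| ≤ 1 := fun i x => by
    rw [abs_of_nonneg (softmax_nonneg a i x)]; exact softmax_le_one a i x
  have hDi : ∀ s i j, Integrable (fun p => D i j (Z s p)) (ν.prod ν') := fun s i j =>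
    Integrable.of_bound ((hDc i j).comp (hZc s)).aestronglyMeasurable 1
      (ae_of_all _ fun p => hDb i j _)
  have hm1 : ∀ s i, Integrable (fun p : EuclideanSpace ℝ ι × EuclideanSpace ℝ ι => p.1 i * softmax a i (Z s p)) (ν.prod ν') := by
    intro s i
    simpa [mul_comm] using (hi1 i).bdd_mul ((continuous_softmax a i).comp
      (hZc s)).aestronglyMeasurable (ae_of_all _ fun p => hsb i (Z s p))
  have hm2 : ∀ s i, Integrable (fun p : EuclideanSpace ℝ ι × EuclideanSpace ℝ ι => p.2 i * softmax a i (Z s p)) (ν.prod ν') := by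
    intro s i
    simpa [mul_comm] using (hi2 i).bdd_mul ((continuous_softmax a i).comp
      (hZc s)).aestronglyMeasurable (ae_of_all _ fun p => hsb i (Z s p))
  -- Integration by parts in the first vector with the second frozen; the chain rule through `Z s`
  -- produces the factor `cos s`.
  have hA : ∀ s i, ∫ p, p.1 i * softmax a i (Z s p) ∂ν.prod ν'
      = Real.cos s * ∑ j, S i j * G s i j := by
    intro s i
    rw [integral_prod_symm _ (hm1 s i)]
    have : ∀ y, ∫ x, x i * softmax a i (Z s (x, y)) ∂ν
        = ∑ j, S i j * ∫ x, Real.cos s * D i j (Z s (x, y)) ∂ν := by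
      intro y
      refine integral_eval_mul_multivariateGaussian hS i
        (F := fun x => softmax a i (Z s (x, y))) (D := fun j x => Real.cos s * D i j (Z s (x, y)))
        (fun x => ?_) (fun j => ?_) (C := 1) (fun x => hsb i _) (C' := 1) (fun j x => ?_)
      · have h1 : HasFDerivAt (fun x : EuclideanSpace ℝ ι => Z s (x, y))
            (Real.cos s • ContinuousLinearMap.id ℝ (EuclideanSpace ℝ ι)) x :=
          ((hasFDerivAt_id x).const_smul (Real.cos s)).add_const (Real.sin s • y)
        refine ((hasFDerivAt_softmax a i (Z s (x, y))).comp x h1).congr_fderiv ?_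
        ext v
        simp only [D, sum_apply, ContinuousLinearMap.comp_apply, smul_apply,
          ContinuousLinearMap.id_apply, map_smul, smul_eq_mul]
        rw [Finset.mul_sum]
        exact Finset.sum_congr rfl fun j _ => by ring
      · exact continuous_const.mul ((hDc i j).comp ((hZc s).comp (by fun_prop)))
      · rw [abs_mul]
        exact mul_le_one₀ (Real.abs_cos_le_one s) (abs_nonneg _) (hDb i j _)
    simp_rw [this, integral_const_mul]
    rw [integral_finsetSum]
    · simp_rw [integral_const_mul, Finset.mul_sum]
      refine Finset.sum_congr rfl fun j _ => ?_
      rw [← integral_prod_symm _ (hDi s i j)]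
      ring
    · intro j _
      exact ((hDi s i j).integral_prod_right.const_mul _).const_mul _
  have hB : ∀ s i, ∫ p, p.2 i * softmax a i (Z s p) ∂ν.prod ν'
      = Real.sin s * ∑ j, S' i j * G s i j := by
    intro s i
    rw [integral_prod _ (hm2 s i)]
    have : ∀ x, ∫ y, y i * softmax a i (Z s (x, y)) ∂ν'
        = ∑ j, S' i j * ∫ y, Real.sin s * D i j (Z s (x, y)) ∂ν' := by
      intro x
      refine integral_eval_mul_multivariateGaussian hS' i
        (F := fun y => softmax a i (Z s (x, y))) (D := fun j y => Real.sin s * D i j (Z s (x, y)))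
        (fun y => ?_) (fun j => ?_) (C := 1) (fun y => hsb i _) (C' := 1) (fun j y => ?_)
      · have h1 : HasFDerivAt (fun y : EuclideanSpace ℝ ι => Z s (x, y))
            (Real.sin s • ContinuousLinearMap.id ℝ (EuclideanSpace ℝ ι)) y :=
          ((hasFDerivAt_id y).const_smul (Real.sin s)).const_add (Real.cos s • x)
        refine ((hasFDerivAt_softmax a i (Z s (x, y))).comp y h1).congr_fderiv ?_
        ext v
        simp only [D, sum_apply, ContinuousLinearMap.comp_apply, smul_apply,
          ContinuousLinearMap.id_apply, map_smul, smul_eq_mul]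
        rw [Finset.mul_sum]
        exact Finset.sum_congr rfl fun j _ => by ring
      · exact continuous_const.mul ((hDc i j).comp ((hZc s).comp (by fun_prop)))
      · rw [abs_mul]
        exact mul_le_one₀ (Real.abs_sin_le_one s) (abs_nonneg _) (hDb i j _)
    simp_rw [this, integral_const_mul]
    rw [integral_finsetSum]
    · simp_rw [integral_const_mul, Finset.mul_sum]
      refine Finset.sum_congr rfl fun j _ => ?_
      rw [← integral_prod _ (hDi s i j)]
      ring
    · intro j _
      exact ((hDi s i j).integral_prod_left.const_mul _).const_mul _
  have hφ'v : ∀ s, ∫ p, φ' s p ∂ν.prod ν'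
      = Real.sin s * Real.cos s * ∑ i, ∑ j, (S' i j - S i j) * G s i j := by
    intro s
    have e : ∀ p, φ' s p = ∑ i, (-Real.sin s * (p.1 i * softmax a i (Z s p))
        + Real.cos s * (p.2 i * softmax a i (Z s p))) := fun p =>
      Finset.sum_congr rfl fun i _ => by ring
    have hsum : ∀ i, Integrable (fun p : EuclideanSpace ℝ ι × EuclideanSpace ℝ ι =>
        -Real.sin s * (p.1 i * softmax a i (Z s p)) + Real.cos s * (p.2 i * softmax a i (Z s p)))
        (ν.prod ν') := fun i => ((hm1 s i).const_mul _).add ((hm2 s i).const_mul _)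
    simp_rw [e]
    rw [integral_finsetSum _ fun i _ => hsum i, Finset.mul_sum]
    refine Finset.sum_congr rfl fun i _ => ?_
    rw [integral_add ((hm1 s i).const_mul _) ((hm2 s i).const_mul _), integral_const_mul,
      integral_const_mul, hA, hB]
    simp_rw [sub_mul, Finset.sum_sub_distrib]
    ring
  have hneg : ∀ s ∈ interior (Set.Icc 0 (Real.pi / 2)), deriv φ s ≤ 0 := by
    intro s hs
    rw [interior_Icc] at hs
    rw [(hφd s).deriv, hφ'v]
    have hsin : 0 ≤ Real.sin s :=
      Real.sin_nonneg_of_nonneg_of_le_pi hs.1.le (by linarith [hs.2, Real.pi_pos])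
    have hcos : 0 ≤ Real.cos s :=
      Real.cos_nonneg_of_neg_pi_div_two_le_of_le (by linarith [hs.1, Real.pi_pos]) hs.2.le
    refine mul_nonpos_of_nonneg_of_nonpos (mul_nonneg hsin hcos)
      (Finset.sum_nonpos fun i _ => Finset.sum_nonpos fun j _ => ?_)
    -- Equal variances kill the diagonal terms, where the Hessian of log-sum-exp is nonnegative. Off
    -- the diagonal that Hessian is minus a product of Gibbs weights, so every remaining term is
    -- nonpositive.
    by_cases hij : i = j
    · subst hij; simp [hdiag]
    · refine mul_nonpos_of_nonneg_of_nonpos (sub_nonneg.2 (hle i j))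
        (integral_nonpos fun p => ?_)
      simp only [hij, if_false, zero_sub, mul_neg, Pi.zero_apply]
      exact neg_nonpos.2 (mul_nonneg (softmax_nonneg _ _ _) (softmax_nonneg _ _ _))
  have hanti : AntitoneOn φ (Set.Icc 0 (Real.pi / 2)) :=
    antitoneOn_of_deriv_nonpos (convex_Icc _ _)
      (fun s _ => (hφd s).continuousAt.continuousWithinAt)
      (fun s _ => (hφd s).differentiableAt.differentiableWithinAt) hneg
  have hpi : (0 : ℝ) ≤ Real.pi / 2 := by positivity
  have hfin := hanti (Set.left_mem_Icc.2 hpi) (Set.right_mem_Icc.2 hpi) hpi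
  have h0 : φ 0 = ∫ x, logSumExp a x ∂ν := by
    simp only [φ, Z, Real.cos_zero, Real.sin_zero, one_smul, zero_smul, add_zero]
    rw [integral_fun_fst]
    simp
  have h1 : φ (Real.pi / 2) = ∫ x, logSumExp a x ∂ν' := by
    simp only [φ, Z, Real.cos_pi_div_two, Real.sin_pi_div_two, one_smul, zero_smul, zero_add]
    rw [integral_fun_snd]
    simp
  rwa [h0, h1] at hfin

end LogSumExp

/-! ### Gaussian laws identified by characteristic functions. -/

/-- A finite linear combination of i.i.d. standard Gaussian variables is Gaussian. -/
theorem map_sum_mul_infinitePi_gaussianReal {J : Type*} (F : Finset J) (c : J → ℝ) :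
    (Measure.infinitePi fun _ : J => gaussianReal 0 1).map (fun g => ∑ j ∈ F, c j * g j)
      = gaussianReal 0 (∑ j ∈ F, c j ^ 2).toNNReal := by
  have : IsProbabilityMeasure ((Measure.infinitePi fun _ : J => gaussianReal 0 1).map
      (fun g => ∑ j ∈ F, c j * g j)) :=
    Measure.isProbabilityMeasure_map (Measurable.aemeasurable (by fun_prop))
  refine Measure.ext_of_charFun ?_
  have hind : iIndepFun (fun (j : J) (g : J → ℝ) => c j * g j)
      (Measure.infinitePi fun _ : J => gaussianReal 0 1) :=
    iIndepFun_infinitePi (X := fun j x => c j * x) fun j => by fun_prop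
  rw [iIndepFun.charFun_map_fun_finsetSum_eq_prod (X := fun (j : J) (g : J → ℝ) => c j * g j)
    (fun j _ => ((measurable_pi_apply j).const_mul _).aemeasurable) (hind.restrict _)]
  have hlaw : ∀ j, (Measure.infinitePi fun _ : J => gaussianReal 0 1).map
      (fun g : J → ℝ => c j * g j) = gaussianReal 0 (c j ^ 2).toNNReal := by
    intro j
    have h1 := (measurePreserving_eval_infinitePi (fun _ : J => gaussianReal 0 1) j).map_eq
    have h2 : (fun g : J → ℝ => c j * g j) = (fun x => c j * x) ∘ Function.eval j := rfl
    rw [h2, ← Measure.map_map (by fun_prop) (by fun_prop), h1, gaussianReal_map_const_mul]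
    congr 1
    · simp
    · ext; simp [Real.toNNReal_of_nonneg (sq_nonneg (c j))]
  ext t
  simp only [hlaw, Finset.prod_apply, charFun_gaussianReal, ← Complex.exp_sum]
  congr 1
  rw [Real.coe_toNNReal _ (Finset.sum_nonneg fun _ _ => sq_nonneg _)]
  simp only [Real.coe_toNNReal _ (sq_nonneg _)]
  push_cast
  simp [Finset.sum_mul, Finset.sum_div]

theorem integral_cexp_I_mul_of_map_eq_gaussianReal {Ω : Type*} [MeasurableSpace Ω]
    {P : Measure Ω} {X : Ω → ℝ} (hX : AEMeasurable X P) {v : NNReal}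
    (h : P.map X = gaussianReal 0 v) :
    ∫ ω, Complex.exp (X ω * Complex.I) ∂P = Complex.exp (-(v : ℝ) / 2 : ℝ) := by
  have h1 := charFun_gaussianReal (μ := 0) (v := v) 1
  rw [← h, charFun_apply_real, integral_map hX
    (Measurable.aestronglyMeasurable (by fun_prop))] at h1
  simp only [Complex.ofReal_one, one_mul] at h1
  rw [h1]
  congr 1
  push_cast
  ring

/-- A random vector whose characteristic function is that of a centered Gaussian vector. -/
theorem map_toLp_eq_multivariateGaussian {ι Ω : Type*} [Fintype ι] [DecidableEq ι]
    [MeasurableSpace Ω] {P : Measure Ω} [IsProbabilityMeasure P] {X : Ω → ι → ℝ}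
    (hX : ∀ i, Measurable fun ω => X ω i) {K : Matrix ι ι ℝ} (hK : ∀ i j, K i j = K j i)
    (h : ∀ t : ι → ℝ, ∫ ω, Complex.exp ((∑ i, t i * X ω i : ℝ) * Complex.I) ∂P
      = Complex.exp (-(∑ i, ∑ j, t i * t j * K i j) / 2 : ℝ)) :
    K.PosSemidef ∧ P.map (fun ω => WithLp.toLp 2 (X ω)) = multivariateGaussian 0 K := by
  have hXm : Measurable fun ω => WithLp.toLp 2 (X ω) :=
    (WithLp.measurable_toLp 2 _).comp (measurable_pi_lambda _ hX)
  have hq : ∀ t : ι → ℝ, t ⬝ᵥ K.mulVec t = ∑ i, ∑ j, t i * t j * K i j := by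
    intro t
    simp only [dotProduct, Matrix.mulVec, Finset.mul_sum]
    exact Finset.sum_congr rfl fun i _ => Finset.sum_congr rfl fun j _ => by ring
  have hpos : K.PosSemidef := by
    refine Matrix.PosSemidef.of_dotProduct_mulVec_nonneg ?_ fun t => ?_
    · ext i j; simpa using hK j i
    -- A characteristic function has modulus at most one, so `exp (-q/2) ≤ 1`, which forces the
    -- quadratic form `q` to be nonnegative.
    · have h1 : ‖∫ ω, Complex.exp ((∑ i, t i * X ω i : ℝ) * Complex.I) ∂P‖ ≤ 1 := by
        refine (norm_integral_le_of_norm_le_const (C := 1) (ae_of_all _ fun ω => ?_)).trans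
          (by simp)
        rw [Complex.norm_exp_ofReal_mul_I]
      rw [h t, Complex.norm_exp, Complex.ofReal_re, Real.exp_le_one_iff, ← hq] at h1
      rw [star_trivial]
      linarith
  refine ⟨hpos, ?_⟩
  have := Measure.isProbabilityMeasure_map (μ := P) hXm.aemeasurable
  refine Measure.ext_of_charFun ?_
  ext t
  rw [charFun_multivariateGaussian hpos, charFun_apply, integral_map hXm.aemeasurable
    (Measurable.aestronglyMeasurable (by fun_prop))]
  have h2 := h t
  simp only [PiLp.inner_apply, inner_zero_right, Complex.ofReal_zero, zero_mul, zero_sub]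
  simp only [RCLike.inner_apply, conj_trivial]
  rw [h2, hq]
  congr 1
  push_cast
  ring

/-! ### The Hamiltonian as a Gaussian field with covariance `N ξ(overlap)`. -/

namespace SKFI

variable {N : ℕ}

/-- The overlap `N⁻¹ ∑ᵢ σᵢ τᵢ` of two configurations. -/
noncomputable def overlap (σ τ : Config N) : ℝ := (∑ i, spin σ i * spin τ i) / N

theorem spin_mul_self (σ : Config N) (i : Fin N) : spin σ i * spin σ i = 1 := by
  rcases Int.units_eq_one_or (σ i) with h | h <;> simp [spin, h]

theorem abs_spin (σ : Config N) (i : Fin N) : |spin σ i| = 1 := by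
  rcases Int.units_eq_one_or (σ i) with h | h <;> simp [spin, h]

theorem overlap_comm (σ τ : Config N) : overlap σ τ = overlap τ σ := by
  simp only [overlap, mul_comm]

theorem overlap_self (hN : N ≠ 0) (σ : Config N) : overlap σ σ = 1 := by
  have : (N : ℝ) ≠ 0 := by exact_mod_cast hN
  simp [overlap, spin_mul_self, this]

theorem abs_overlap_le_one (σ τ : Config N) : |overlap σ τ| ≤ 1 := by
  rw [overlap, abs_div, Nat.abs_cast]
  refine div_le_one_of_le₀ ?_ (Nat.cast_nonneg N)
  refine (Finset.abs_sum_le_sum_abs _ _).trans ?_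
  simp [abs_mul, abs_spin]

/-- The `2p`-spin part of the Hamiltonian. -/
noncomputable def pSpinTerm (B : ℕ+ → ℝ) (g : CouplingIndex N → ℝ) (σ : Config N) (p : ℕ+) : ℝ :=
  B p / (N : ℝ) ^ (((p : ℕ) : ℝ) - 1 / 2) *
    ∑ i : Fin (2 * (p : ℕ)) → Fin N, g ⟨p, i⟩ * ∏ k, spin σ (i k)

theorem measurable_pSpinTerm (B : ℕ+ → ℝ) (σ : Config N) (p : ℕ+) :
    Measurable fun g : CouplingIndex N → ℝ => pSpinTerm B g σ p := by
  unfold pSpinTerm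
  fun_prop

theorem measurable_hamiltonianSK (B : ℕ+ → ℝ) (σ : Config N) :
    Measurable fun g : CouplingIndex N → ℝ => hamiltonianSK B g σ :=
  Measurable.tsum fun p => measurable_pSpinTerm B σ p

instance : IsProbabilityMeasure (couplingLaw N) := by
  unfold couplingLaw
  infer_instance

theorem sum_prod_spin_mul_prod_spin (σ τ : Config N) (n : ℕ) :
    ∑ i : Fin n → Fin N, (∏ k, spin σ (i k)) * ∏ k, spin τ (i k)
      = (∑ i, spin σ i * spin τ i) ^ n := by
  rw [Fintype.sum_pow]
  simp only [Finset.prod_mul_distrib]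

/-- Expanding the square, the sum over multi-indices factorizes into a power of `∑ i, σ i τ i`. The
left side is the variance of a linear combination of `2p`-spin terms, so this is where the
covariance becomes a function of the overlap. -/
theorem sum_sq_coupling_coefficient {ι : Type*} [Fintype ι] (B : ℕ+ → ℝ) (r : ι → Config N)
    (t : ι → ℝ) (p : ℕ+) :
    ∑ idx : Fin (2 * (p : ℕ)) → Fin N, (B p / (N : ℝ) ^ (((p : ℕ) : ℝ) - 1 / 2) *
      ∑ i, t i * ∏ k, spin (r i) (idx k)) ^ 2
      = ∑ i, ∑ j, t i * t j * (N * (B p ^ 2 * overlap (r i) (r j) ^ (2 * (p : ℕ)))) := by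
  have hp : (p : ℕ) ≠ 0 := p.ne_zero
  rcases Nat.eq_zero_or_pos N with rfl | hN
  · have : Nonempty (Fin (2 * (p : ℕ))) := ⟨⟨0, by have := p.pos; omega⟩⟩
    simp
  have hN0 : (0 : ℝ) < N := by exact_mod_cast hN
  -- The exponent `p - 1/2` is chosen so that, after normalizing the overlap, exactly one factor `N`
  -- survives.
  have hsq : ((N : ℝ) ^ (((p : ℕ) : ℝ) - 1 / 2)) ^ 2 * N = (N : ℝ) ^ (2 * (p : ℕ)) := by
    rw [← Real.rpow_natCast, ← Real.rpow_mul hN0.le]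
    nth_rewrite 2 [← Real.rpow_one (N : ℝ)]
    rw [← Real.rpow_add hN0, ← Real.rpow_natCast]
    congr 1
    push_cast
    ring
  have hpow : ((N : ℝ) ^ (((p : ℕ) : ℝ) - 1 / 2)) ≠ 0 := (Real.rpow_pos_of_pos hN0 _).ne'
  have e1 : ∀ idx : Fin (2 * (p : ℕ)) → Fin N, (B p / (N : ℝ) ^ (((p : ℕ) : ℝ) - 1 / 2) *
      ∑ i, t i * ∏ k, spin (r i) (idx k)) ^ 2
      = ∑ i, ∑ j, t i * t j * ((B p / (N : ℝ) ^ (((p : ℕ) : ℝ) - 1 / 2)) ^ 2 *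
        ((∏ k, spin (r i) (idx k)) * ∏ k, spin (r j) (idx k))) := by
    intro idx
    rw [mul_pow, sq (∑ i, _), Finset.sum_mul_sum, Finset.mul_sum]
    refine Finset.sum_congr rfl fun i _ => ?_
    rw [Finset.mul_sum]
    exact Finset.sum_congr rfl fun j _ => by ring
  simp_rw [e1]
  rw [Finset.sum_comm]
  refine Finset.sum_congr rfl fun i _ => ?_
  rw [Finset.sum_comm]
  refine Finset.sum_congr rfl fun j _ => ?_
  rw [← Finset.mul_sum, ← Finset.mul_sum, sum_prod_spin_mul_prod_spin]
  congr 1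
  rw [overlap, div_pow, div_pow, ← hsq]
  field_simp

theorem map_sum_pSpinTerm {ι : Type*} [Fintype ι] (B : ℕ+ → ℝ) (r : ι → Config N) (t : ι → ℝ)
    (F : Finset ℕ+) :
    (couplingLaw N).map (fun g => ∑ p ∈ F, ∑ i, t i * pSpinTerm B g (r i) p)
      = gaussianReal 0 (∑ p ∈ F, ∑ i, ∑ j, t i * t j *
        (N * (B p ^ 2 * overlap (r i) (r j) ^ (2 * (p : ℕ))))).toNNReal := by
  let c : CouplingIndex N → ℝ := fun x => B x.1 / (N : ℝ) ^ (((x.1 : ℕ) : ℝ) - 1 / 2) *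
      ∑ i, t i * ∏ k, spin (r i) (x.2 k)
  have e : (fun g : CouplingIndex N → ℝ => ∑ p ∈ F, ∑ i, t i * pSpinTerm B g (r i) p)
      = fun g => ∑ x ∈ F.sigma fun _ => Finset.univ, c x * g x := by
    ext g
    rw [Finset.sum_sigma]
    refine Finset.sum_congr rfl fun p _ => ?_
    simp only [pSpinTerm, c, Finset.mul_sum, Finset.sum_mul]
    rw [Finset.sum_comm]
    exact Finset.sum_congr rfl fun _ _ => Finset.sum_congr rfl fun _ _ => by ring
  rw [e, couplingLaw, map_sum_mul_infinitePi_gaussianReal, Finset.sum_sigma]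
  simp only [c, sum_sq_coupling_coefficient]

theorem summable_sq_mul_pow {B : ℕ+ → ℝ} (hB : Summable fun p : ℕ+ => (2 : ℝ) ^ (p : ℕ) * B p ^ 2)
    {x : ℝ} (hx : |x| ≤ 1) : Summable fun p : ℕ+ => B p ^ 2 * x ^ (2 * (p : ℕ)) := by
  refine Summable.of_nonneg_of_le (fun p => ?_) (fun p => ?_) hB
  · rw [pow_mul]; positivity
  · have h1 : x ^ (2 * (p : ℕ)) ≤ 1 := by
      rw [pow_mul]
      exact pow_le_one₀ (sq_nonneg x) ((sq_le_one_iff_abs_le_one x).2 hx)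
    have h2 : (1 : ℝ) ≤ 2 ^ (p : ℕ) := one_le_pow₀ (by norm_num)
    have h3 := sq_nonneg (B p)
    calc B p ^ 2 * x ^ (2 * (p : ℕ)) ≤ B p ^ 2 * 1 := by gcongr
      _ = 1 * B p ^ 2 := by ring
      _ ≤ 2 ^ (p : ℕ) * B p ^ 2 := by gcongr

/-- The weights `2^p` in the summability condition give `∑ 2^p T_p²` a finite mean, where `T_p` is
the `2p`-spin term; it is therefore finite almost surely, and `|T_p| ≤ 2^{-p} + 2^p T_p²` yields
absolute convergence. -/
theorem ae_summable_pSpinTerm {B : ℕ+ → ℝ}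
    (hB : Summable fun p : ℕ+ => (2 : ℝ) ^ (p : ℕ) * B p ^ 2) (σ : Config N) :
    ∀ᵐ g ∂couplingLaw N, Summable (pSpinTerm B g σ) := by
  have hlaw : ∀ p, (couplingLaw N).map (fun g => pSpinTerm B g σ p)
      = gaussianReal 0 (N * (B p ^ 2 * overlap σ σ ^ (2 * (p : ℕ)))).toNNReal := by
    intro p
    have := map_sum_pSpinTerm B (fun _ : Unit => σ) (fun _ => 1) {p}
    simpa using this
  have hsq : ∀ p, Integrable (fun g => pSpinTerm B g σ p ^ 2) (couplingLaw N) ∧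
      ∫ g, pSpinTerm B g σ p ^ 2 ∂couplingLaw N = N * (B p ^ 2 * overlap σ σ ^ (2 * (p : ℕ))) := by
    intro p
    have hm := (measurable_pSpinTerm B σ p).aemeasurable (μ := couplingLaw N)
    have hv : 0 ≤ N * (B p ^ 2 * overlap σ σ ^ (2 * (p : ℕ))) := by rw [pow_mul]; positivity
    have h1 : MemLp id 2 (gaussianReal 0 (N * (B p ^ 2 * overlap σ σ ^ (2 * (p : ℕ)))).toNNReal) :=
      IsGaussian.memLp_two_id
    have h2 := variance_id_gaussianReal (μ := 0)
      (v := (N * (B p ^ 2 * overlap σ σ ^ (2 * (p : ℕ)))).toNNReal)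
    rw [variance_of_integral_eq_zero aemeasurable_id (by simp)] at h2
    have h3 := h1.integrable_sq
    rw [← hlaw p] at h2 h3
    rw [integral_map hm (Measurable.aestronglyMeasurable (by fun_prop))] at h2
    rw [integrable_map_measure (Measurable.aestronglyMeasurable (by fun_prop)) hm] at h3
    refine ⟨h3, ?_⟩
    rw [Real.coe_toNNReal _ hv] at h2
    exact h2
  have key := summable_norm_of_tsum_eLpNorm_ne_top (μ := couplingLaw N) (p := 1) le_rfl
    (f := fun (p : ℕ+) g => (2 : ℝ) ^ (p : ℕ) * pSpinTerm B g σ p ^ 2)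
    (fun p => ((hsq p).1.const_mul _).1) ?_
  · filter_upwards [key] with g hg
    have hgeo : Summable fun p : ℕ+ => (1 / 2 : ℝ) ^ (p : ℕ) :=
      (summable_geometric_of_lt_one (by norm_num) (by norm_num)).comp_injective
        PNat.coe_injective
    refine Summable.of_norm_bounded (hgeo.add hg) fun p => ?_
    rw [Real.norm_eq_abs, Real.norm_eq_abs, abs_mul, abs_pow, abs_pow,
      abs_two]
    have h1 : (1 / 2 : ℝ) ^ (p : ℕ) * 2 ^ (p : ℕ) = 1 := by
      rw [← mul_pow]; norm_num
    have h2 : (0 : ℝ) ≤ (1 / 2) ^ (p : ℕ) := by positivity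
    have h3 : (0 : ℝ) ≤ 2 ^ (p : ℕ) := by positivity
    set y := |pSpinTerm B g σ p|
    set a := (1 / 2 : ℝ) ^ (p : ℕ)
    set b := (2 : ℝ) ^ (p : ℕ)
    -- The arithmetic-geometric mean inequality `2y ≤ a + b y²` for `a b = 1`, as a completed
    -- square.
    have h4 : a * (b * y - 1) ^ 2 = b * y ^ 2 - 2 * y + a := by
      linear_combination (b * y ^ 2 - 2 * y) * h1
    have h5 := mul_nonneg h2 (sq_nonneg (b * y - 1))
    have h6 := mul_nonneg h3 (sq_nonneg y)
    linarith
  · have hnorm : ∀ p : ℕ+, eLpNorm (fun g => (2 : ℝ) ^ (p : ℕ) * pSpinTerm B g σ p ^ 2) 1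
        (couplingLaw N) = ENNReal.ofReal ((2 : ℝ) ^ (p : ℕ) *
          (N * (B p ^ 2 * overlap σ σ ^ (2 * (p : ℕ))))) := by
      intro p
      rw [eLpNorm_one_eq_lintegral_enorm,
        ← ofReal_integral_norm_eq_lintegral_enorm ((hsq p).1.const_mul _)]
      congr 1
      rw [← (hsq p).2, ← integral_const_mul]
      refine integral_congr_ae (ae_of_all _ fun g => ?_)
      exact abs_of_nonneg (by positivity)
    simp_rw [hnorm]
    refine Summable.tsum_ofReal_ne_top ?_
    refine Summable.of_nonneg_of_le (fun p => ?_) (fun p => ?_) (hB.mul_left (N : ℝ))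
    · rw [pow_mul]; positivity
    · have h1 : overlap σ σ ^ (2 * (p : ℕ)) ≤ 1 := by
        rw [pow_mul]
        exact pow_le_one₀ (sq_nonneg _)
          ((sq_le_one_iff_abs_le_one _).2 (abs_overlap_le_one σ σ))
      calc (2 : ℝ) ^ (p : ℕ) * (N * (B p ^ 2 * overlap σ σ ^ (2 * (p : ℕ))))
          ≤ (2 : ℝ) ^ (p : ℕ) * (N * (B p ^ 2 * 1)) := by gcongr
        _ = N * (2 ^ (p : ℕ) * B p ^ 2) := by ring

/-- The characteristic function of the Hamiltonian as a Gaussian vector. -/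
theorem integral_cexp_hamiltonianSK {ι : Type*} [Fintype ι] {B : ℕ+ → ℝ}
    (hB : Summable fun p : ℕ+ => (2 : ℝ) ^ (p : ℕ) * B p ^ 2) (r : ι → Config N) (t : ι → ℝ) :
    ∫ g, Complex.exp ((∑ i, t i * hamiltonianSK B g (r i) : ℝ) * Complex.I) ∂couplingLaw N
      = Complex.exp (-(∑ i, ∑ j, t i * t j * (N * xi B (overlap (r i) (r j)))) / 2 : ℝ) := by
  have hq : HasSum (fun p : ℕ+ => ∑ i, ∑ j, t i * t j *
      (N * (B p ^ 2 * overlap (r i) (r j) ^ (2 * (p : ℕ)))))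
      (∑ i, ∑ j, t i * t j * (N * xi B (overlap (r i) (r j)))) :=
    hasSum_sum fun i _ => hasSum_sum fun j _ =>
      ((summable_sq_mul_pow hB (abs_overlap_le_one (r i) (r j))).hasSum.mul_left _).mul_left _
  have hpart : ∀ F : Finset ℕ+, ∫ g, Complex.exp ((∑ p ∈ F, ∑ i, t i * pSpinTerm B g (r i) p : ℝ)
      * Complex.I) ∂couplingLaw N = Complex.exp (-(∑ p ∈ F, ∑ i, ∑ j, t i * t j *
      (N * (B p ^ 2 * overlap (r i) (r j) ^ (2 * (p : ℕ))))) / 2 : ℝ) := by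
    intro F
    rw [integral_cexp_I_mul_of_map_eq_gaussianReal (Measurable.aemeasurable
      (Finset.measurable_sum _ fun p _ => Finset.measurable_sum _ fun i _ =>
        (measurable_pSpinTerm B (r i) p).const_mul _)) (map_sum_pSpinTerm B r t F),
      Real.coe_toNNReal]
    refine Finset.sum_nonneg fun p _ => ?_
    rw [← sum_sq_coupling_coefficient]
    exact Finset.sum_nonneg fun _ _ => sq_nonneg _
  -- The partial sums converge almost surely and the exponentials have modulus one, so dominated
  -- convergence passes the finite formula to the full series.
  have hlim1 : Tendsto (fun F : Finset ℕ+ => ∫ g, Complex.exp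
      ((∑ p ∈ F, ∑ i, t i * pSpinTerm B g (r i) p : ℝ) * Complex.I) ∂couplingLaw N) atTop
      (𝓝 (∫ g, Complex.exp ((∑ i, t i * hamiltonianSK B g (r i) : ℝ) * Complex.I)
        ∂couplingLaw N)) := by
    refine tendsto_integral_filter_of_dominated_convergence (fun _ => 1) ?_ ?_
      (integrable_const _) ?_
    · refine Eventually.of_forall fun F => Measurable.aestronglyMeasurable ?_
      have : Measurable fun g : CouplingIndex N → ℝ =>
          ∑ p ∈ F, ∑ i, t i * pSpinTerm B g (r i) p :=
        Finset.measurable_sum _ fun p _ => Finset.measurable_sum _ fun i _ =>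
          (measurable_pSpinTerm B (r i) p).const_mul _
      fun_prop
    · exact Eventually.of_forall fun F => ae_of_all _ fun g => by
        rw [Complex.norm_exp_ofReal_mul_I]
    · have hs : ∀ᵐ g ∂couplingLaw N, ∀ i, Summable (pSpinTerm B g (r i)) :=
        ae_all_iff.2 fun i => ae_summable_pSpinTerm hB (r i)
      filter_upwards [hs] with g hg
      have hsum : HasSum (fun p => ∑ i, t i * pSpinTerm B g (r i) p)
          (∑ i, t i * hamiltonianSK B g (r i)) :=
        hasSum_sum fun i _ => (hg i).hasSum.mul_left _
      have hc : Continuous fun x : ℝ => Complex.exp (x * Complex.I) := by fun_prop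
      exact (hc.tendsto _).comp hsum
  have hlim2 : Tendsto (fun F : Finset ℕ+ => Complex.exp (-(∑ p ∈ F, ∑ i, ∑ j, t i * t j *
      (N * (B p ^ 2 * overlap (r i) (r j) ^ (2 * (p : ℕ))))) / 2 : ℝ)) atTop
      (𝓝 (Complex.exp (-(∑ i, ∑ j, t i * t j * (N * xi B (overlap (r i) (r j)))) / 2 : ℝ))) := by
    have hc : Continuous fun x : ℝ => Complex.exp (-x / 2 : ℝ) := by fun_prop
    exact (hc.tendsto _).comp hq
  simp_rw [hpart] at hlim1
  exact tendsto_nhds_unique hlim1 hlim2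

/-- The covariance matrix of the Hamiltonian at the configurations `r i`. -/
noncomputable def covSK {ι : Type*} (B : ℕ+ → ℝ) (r : ι → Config N) : Matrix ι ι ℝ :=
  Matrix.of fun i j => N * xi B (overlap (r i) (r j))

theorem map_hamiltonianSK {ι : Type*} [Fintype ι] [DecidableEq ι] {B : ℕ+ → ℝ}
    (hB : Summable fun p : ℕ+ => (2 : ℝ) ^ (p : ℕ) * B p ^ 2) (r : ι → Config N) :
    (covSK B r).PosSemidef ∧
      (couplingLaw N).map (fun g => WithLp.toLp 2 fun i => hamiltonianSK B g (r i))
        = multivariateGaussian 0 (covSK B r) :=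
  map_toLp_eq_multivariateGaussian (fun i => measurable_hamiltonianSK B (r i))
    (fun i j => by simp [covSK, overlap_comm (r i)]) (integral_cexp_hamiltonianSK hB r)

/-- Characteristic functions of independent fields multiply, so covariances add. The free families
`r` and `r'` will be the restrictions of a configuration of `N + M` spins to its two blocks, which
puts the decoupled system on the same index set as the full one. -/
theorem map_hamiltonianSK_add {ι : Type*} [Fintype ι] [DecidableEq ι] {M : ℕ} {B : ℕ+ → ℝ}
    (hB : Summable fun p : ℕ+ => (2 : ℝ) ^ (p : ℕ) * B p ^ 2) (r : ι → Config N)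
    (r' : ι → Config M) :
    (covSK B r + covSK B r').PosSemidef ∧
      ((couplingLaw N).prod (couplingLaw M)).map (fun g => WithLp.toLp 2 fun i =>
        hamiltonianSK B g.1 (r i) + hamiltonianSK B g.2 (r' i))
        = multivariateGaussian 0 (covSK B r + covSK B r') := by
  refine map_toLp_eq_multivariateGaussian (fun i =>
    ((measurable_hamiltonianSK B (r i)).comp measurable_fst).add
      ((measurable_hamiltonianSK B (r' i)).comp measurable_snd))
    (fun i j => by simp [covSK, overlap_comm (r i), overlap_comm (r' i)]) fun t => ?_
  have e : ∀ g : (CouplingIndex N → ℝ) × (CouplingIndex M → ℝ), Complex.exp ((∑ i, t i *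
      (hamiltonianSK B g.1 (r i) + hamiltonianSK B g.2 (r' i)) : ℝ) * Complex.I)
      = Complex.exp ((∑ i, t i * hamiltonianSK B g.1 (r i) : ℝ) * Complex.I) *
        Complex.exp ((∑ i, t i * hamiltonianSK B g.2 (r' i) : ℝ) * Complex.I) := by
    intro g
    rw [← Complex.exp_add]
    congr 1
    push_cast
    simp only [mul_add, Finset.sum_add_distrib, add_mul]
  change _ = Complex.exp ((-(∑ i, ∑ j, t i * t j * (N * xi B (overlap (r i) (r j)) +
    M * xi B (overlap (r' i) (r' j)))) / 2 : ℝ) : ℂ)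
  refine (integral_congr_ae (ae_of_all _ e)).trans ?_
  rw [integral_prod_mul (fun g => Complex.exp ((∑ i, t i * hamiltonianSK B g (r i) : ℝ)
    * Complex.I)) (fun g => Complex.exp ((∑ i, t i * hamiltonianSK B g (r' i) : ℝ)
    * Complex.I)), integral_cexp_hamiltonianSK hB, integral_cexp_hamiltonianSK hB,
    ← Complex.exp_add, ← Complex.ofReal_add]
  refine congrArg (fun x : ℝ => Complex.exp x) ?_
  simp only [mul_add, Finset.sum_add_distrib]
  ring

end SKFI

/-! ### Jensen bounds for the mean of log-sum-exp. -/

theorem integral_eval_multivariateGaussian_zero {ι : Type*} [Fintype ι] [DecidableEq ι]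
    (S : Matrix ι ι ℝ) (i : ι) :
    ∫ x, x i ∂multivariateGaussian 0 S = 0 := by
  have h := (EuclideanSpace.proj (𝕜 := ℝ) i : EuclideanSpace ℝ ι →L[ℝ] ℝ).integral_comp_comm
    (IsGaussian.integrable_fun_id (μ := multivariateGaussian (0 : EuclideanSpace ℝ ι) S))
  simpa using h

section Jensen

variable {ι : Type*} [Fintype ι] [Nonempty ι]

/-- Jensen's inequality for `exp` under the Gibbs weights at the origin: log-sum-exp lies above its
tangent plane there. Averaged over a centered vector, the linear term disappears. -/
theorem logSumExp_zero_add_le (a : ι → ℝ) (x : EuclideanSpace ℝ ι) :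
    logSumExp a 0 + ∑ i, softmax a i 0 * x i ≤ logSumExp a x := by
  have hpos : 0 < ∑ i, Real.exp (a i) := sum_exp_pos a
  have h0 : logSumExp a 0 = Real.log (∑ i, Real.exp (a i)) := by simp [logSumExp]
  have hw : ∀ i, softmax a i 0 = Real.exp (a i) / ∑ j, Real.exp (a j) := fun i => by simp [softmax]
  have hsum : ∑ i, softmax a i 0 = 1 := by
    simp_rw [hw, ← Finset.sum_div]
    exact div_self hpos.ne'
  have hjensen := convexOn_exp.map_sum_le (t := Finset.univ) (w := fun i => softmax a i 0)
    (p := fun i => x i) (fun i _ => softmax_nonneg a i 0) hsum (fun _ _ => Set.mem_univ _)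
  simp only [smul_eq_mul] at hjensen
  have hrhs : ∑ i, softmax a i 0 * Real.exp (x i)
      = (∑ i, Real.exp (x i + a i)) / ∑ i, Real.exp (a i) := by
    rw [Finset.sum_div]
    refine Finset.sum_congr rfl fun i _ => ?_
    rw [hw, Real.exp_add]
    ring
  rw [hrhs] at hjensen
  have h1 := Real.log_le_log (Real.exp_pos _) hjensen
  rw [Real.log_exp, Real.log_div (sum_exp_pos _).ne' hpos.ne'] at h1
  rw [h0, logSumExp]
  linarith

variable [DecidableEq ι]

theorem log_sum_exp_le_integral_logSumExp (a : ι → ℝ) (S : Matrix ι ι ℝ) :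
    Real.log (∑ i, Real.exp (a i)) ≤ ∫ x, logSumExp a x ∂multivariateGaussian 0 S := by
  have hi : ∀ i, Integrable (fun x : EuclideanSpace ℝ ι => softmax a i 0 * x i)
      (multivariateGaussian 0 S) := fun i =>
    (integrable_eval_multivariateGaussian S i).const_mul _
  have h := integral_mono ((integrable_const (logSumExp a 0)).add
    (integrable_finsetSum _ fun i _ => hi i)) (integrable_logSumExp a S)
    (fun x => logSumExp_zero_add_le a x)
  simp only [Pi.add_apply] at h
  rw [integral_add (integrable_const _) (integrable_finsetSum _ fun i _ => hi i),
    integral_finsetSum _ fun i _ => hi i] at h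
  simp_rw [integral_const_mul, integral_eval_multivariateGaussian_zero] at h
  simpa [logSumExp] using h

/-- The annealed bound: the expectation moves inside the logarithm, and each `𝔼 exp (x i)` equals
`exp (v / 2)`. -/
theorem integral_logSumExp_le (a : ι → ℝ) {S : Matrix ι ι ℝ} (hS : S.PosSemidef) {v : ℝ}
    (hv : ∀ i, S i i = v) :
    ∫ x, logSumExp a x ∂multivariateGaussian 0 S ≤ Real.log (∑ i, Real.exp (a i)) + v / 2 := by
  have hv0 : 0 ≤ v := hv (Classical.arbitrary ι) ▸ hS.diag_nonneg
  have hexp : ∀ i, Integrable (fun x : EuclideanSpace ℝ ι => Real.exp (x i))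
        (multivariateGaussian 0 S) ∧
      ∫ x, Real.exp (x i) ∂multivariateGaussian 0 S = Real.exp (v / 2) := by
    intro i
    have hmp := measurePreserving_eval_multivariateGaussian (μ := 0) hS (i := i)
    have h1 : Integrable (fun y => Real.exp (1 * y))
        (gaussianReal ((0 : EuclideanSpace ℝ ι) i) (S i i).toNNReal) :=
      integrable_exp_mul_gaussianReal 1
    have h2 := mgf_gaussianReal hmp.map_eq 1
    simp only [one_mul] at h1
    refine ⟨hmp.integrable_comp_of_integrable h1, ?_⟩
    simp only [mgf, one_mul] at h2
    rw [h2, hv, Real.coe_toNNReal _ hv0]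
    simp
  have hpos : 0 < ∑ i, Real.exp (a i) := sum_exp_pos a
  -- The annealed partition function. Jensen for `log` is applied as the tangent-line bound `log z ≤
  -- z / c + log c - 1` at this point.
  set c := (∑ i, Real.exp (a i)) * Real.exp (v / 2) with hc
  have hcpos : 0 < c := by positivity
  have hlog : Real.log c = Real.log (∑ i, Real.exp (a i)) + v / 2 := by
    rw [hc, Real.log_mul hpos.ne' (Real.exp_pos _).ne', Real.log_exp]
  have hpt : ∀ x, logSumExp a x ≤ c⁻¹ * ∑ i, Real.exp (a i) * Real.exp (x i) + (Real.log c - 1) := by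
    intro x
    have h1 : ∑ i, Real.exp (a i) * Real.exp (x i) = ∑ i, Real.exp (x i + a i) :=
      Finset.sum_congr rfl fun i _ => by rw [add_comm, Real.exp_add]
    have h2 : 0 < ∑ i, Real.exp (x i + a i) := sum_exp_pos _
    have h3 := Real.log_le_sub_one_of_pos (mul_pos (inv_pos.2 hcpos) h2)
    rw [Real.log_mul (inv_pos.2 hcpos).ne' h2.ne', Real.log_inv] at h3
    rw [h1, logSumExp]
    linarith
  have hi : ∀ i, Integrable (fun x : EuclideanSpace ℝ ι => Real.exp (a i) * Real.exp (x i))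
      (multivariateGaussian 0 S) := fun i => (hexp i).1.const_mul _
  have hi' := (integrable_finsetSum Finset.univ fun i _ => hi i).const_mul c⁻¹
  have h := integral_mono (integrable_logSumExp a S) (hi'.add (integrable_const _)) hpt
  simp only [Pi.add_apply] at h
  rw [integral_add hi' (integrable_const _), integral_const_mul,
    integral_finsetSum _ fun i _ => hi i] at h
  simp_rw [integral_const_mul, (hexp _).2] at h
  rw [← Finset.sum_mul, ← hc, inv_mul_cancel₀ hcpos.ne'] at h
  simp only [integral_const, probReal_univ, one_smul] at h
  linarith

end Jensen

/-! ### Superadditivity, the thermodynamic limit and the free energy sandwich. -/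

theorem measurePreserving_finAppend (ν : Measure ℝ) [IsProbabilityMeasure ν] (N M : ℕ) :
    MeasurePreserving (fun p : (Fin N → ℝ) × (Fin M → ℝ) => Fin.append p.1 p.2)
      ((Measure.pi fun _ => ν).prod (Measure.pi fun _ => ν)) (Measure.pi fun _ => ν) := by
  have hm : Measurable (fun p : (Fin N → ℝ) × (Fin M → ℝ) => Fin.append p.1 p.2) := by
    refine measurable_pi_lambda _ fun i => ?_
    refine Fin.addCases (fun i => ?_) (fun i => ?_) i
    · simp only [Fin.append_left]; fun_prop
    · simp only [Fin.append_right]; fun_prop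
  refine ⟨hm, (Measure.pi_eq fun s hs => ?_).symm⟩
  rw [Measure.map_apply hm (MeasurableSet.univ_pi hs)]
  have : (fun p : (Fin N → ℝ) × (Fin M → ℝ) => Fin.append p.1 p.2) ⁻¹' Set.pi Set.univ s
      = (Set.pi Set.univ fun i => s (Fin.castAdd M i)) ×ˢ
        (Set.pi Set.univ fun i => s (Fin.natAdd N i)) := by
    ext p
    simp only [Set.mem_preimage, Set.mem_pi, Set.mem_univ, true_imp_iff, Set.mem_prod]
    refine ⟨fun h => ⟨fun i => by simpa using h (Fin.castAdd M i),
      fun i => by simpa using h (Fin.natAdd N i)⟩, fun h i => ?_⟩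
    refine Fin.addCases (fun i => ?_) (fun i => ?_) i
    · simpa using h.1 i
    · simpa using h.2 i
  rw [this, Measure.prod_prod, Measure.pi_pi, Measure.pi_pi, Fin.prod_univ_add]

namespace SKFI

variable {N M : ℕ} {B : ℕ+ → ℝ}

/-- Only even powers occur, with nonnegative coefficients, so convexity holds on both signs;
overlaps of blocks may be negative. -/
theorem convexOn_xi (hB : Summable fun p : ℕ+ => (2 : ℝ) ^ (p : ℕ) * B p ^ 2) :
    ConvexOn ℝ (Set.Icc (-1) 1) (xi B) := by
  refine ⟨convex_Icc _ _, fun x hx y hy a b ha hb hab => ?_⟩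
  have hxy := (convex_Icc (-1 : ℝ) 1) hx hy ha hb hab
  simp only [smul_eq_mul] at hxy ⊢
  unfold xi
  have hsx := summable_sq_mul_pow hB (abs_le.2 hx)
  have hsy := summable_sq_mul_pow hB (abs_le.2 hy)
  rw [← tsum_mul_left, ← tsum_mul_left, ← (hsx.mul_left a).tsum_add (hsy.mul_left b)]
  refine (summable_sq_mul_pow hB (abs_le.2 hxy)).tsum_le_tsum (fun p => ?_)
    ((hsx.mul_left a).add (hsy.mul_left b))
  have h := (even_two_mul (p : ℕ)).convexOn_pow (𝕜 := ℝ) |>.2 (Set.mem_univ x)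
    (Set.mem_univ y) ha hb hab
  simp only [smul_eq_mul] at h
  calc B p ^ 2 * (a * x + b * y) ^ (2 * (p : ℕ))
      ≤ B p ^ 2 * (a * x ^ (2 * (p : ℕ)) + b * y ^ (2 * (p : ℕ))) := by gcongr
    _ = _ := by ring

/-- The prefactor `N` covers the empty system, whose self-overlap is `0 / 0 = 0` instead of `1`. -/
theorem natCast_mul_xi_overlap_self (B : ℕ+ → ℝ) (σ : Config N) :
    (N : ℝ) * xi B (overlap σ σ) = N * xi B 1 := by
  rcases eq_or_ne N 0 with rfl | hN
  · simp
  · rw [overlap_self hN]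

theorem natCast_mul_overlap (σ τ : Config N) :
    (N : ℝ) * overlap σ τ = ∑ i, spin σ i * spin τ i := by
  rcases eq_or_ne N 0 with rfl | hN
  · simp
  · have : (N : ℝ) ≠ 0 := by exact_mod_cast hN
    rw [overlap, mul_div_cancel₀ _ this]

/-- The total overlap is the size-weighted mean of the block overlaps, and `ξ` is convex. This is
the covariance ordering required by the comparison inequality. -/
theorem add_mul_xi_overlap_le (hB : Summable fun p : ℕ+ => (2 : ℝ) ^ (p : ℕ) * B p ^ 2)
    (σ τ : Config (N + M)) :
    ((N + M : ℕ) : ℝ) * xi B (overlap σ τ) ≤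
      N * xi B (overlap (fun i => σ (Fin.castAdd M i)) (fun i => τ (Fin.castAdd M i))) +
      M * xi B (overlap (fun i => σ (Fin.natAdd N i)) (fun i => τ (Fin.natAdd N i))) := by
  set R₁ := overlap (fun i => σ (Fin.castAdd M i)) (fun i => τ (Fin.castAdd M i)) with hR₁
  set R₂ := overlap (fun i => σ (Fin.natAdd N i)) (fun i => τ (Fin.natAdd N i)) with hR₂
  have hsum : ((N + M : ℕ) : ℝ) * overlap σ τ = N * R₁ + M * R₂ := by
    rw [natCast_mul_overlap, hR₁, hR₂, natCast_mul_overlap, natCast_mul_overlap,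
      Fin.sum_univ_add]
    rfl
  rcases Nat.eq_zero_or_pos (N + M) with h0 | h0
  · obtain ⟨rfl, rfl⟩ : N = 0 ∧ M = 0 := by omega
    simp
  have hpos : (0 : ℝ) < (N + M : ℕ) := by exact_mod_cast h0
  have hcast : ((N + M : ℕ) : ℝ) = N + M := by push_cast; ring
  have hR : overlap σ τ = (N / (N + M : ℕ) : ℝ) * R₁ + (M / (N + M : ℕ) : ℝ) * R₂ := by
    field_simp
    linarith
  have hmem₁ : R₁ ∈ Set.Icc (-1) 1 := abs_le.1 (abs_overlap_le_one _ _)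
  have hmem₂ : R₂ ∈ Set.Icc (-1) 1 := abs_le.1 (abs_overlap_le_one _ _)
  have ha : 0 ≤ (N / (N + M : ℕ) : ℝ) := by positivity
  have hb : 0 ≤ (M / (N + M : ℕ) : ℝ) := by positivity
  have h := (convexOn_xi hB).2 hmem₁ hmem₂ ha hb
    (by rw [← add_div, ← hcast, div_self hpos.ne'])
  simp only [smul_eq_mul] at h
  rw [hR]
  calc ((N + M : ℕ) : ℝ) * xi B ((N / (N + M : ℕ) : ℝ) * R₁ + (M / (N + M : ℕ) : ℝ) * R₂)
      ≤ ((N + M : ℕ) : ℝ) * ((N / (N + M : ℕ) : ℝ) * xi B R₁ + (M / (N + M : ℕ) : ℝ) * xi B R₂) := by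
        gcongr
    _ = _ := by field_simp

/-- The free energy averaged over the couplings, for fixed external fields. -/
noncomputable def quenchedLog (B : ℕ+ → ℝ) (h : Fin N → ℝ) : ℝ :=
  ∫ g, Real.log (partitionSK B g h) ∂couplingLaw N

theorem measurable_toLp_hamiltonianSK {ι : Type*} [Fintype ι] (B : ℕ+ → ℝ) (r : ι → Config N) :
    Measurable fun g : CouplingIndex N → ℝ =>
      WithLp.toLp 2 fun i => hamiltonianSK B g (r i) :=
  (WithLp.measurable_toLp 2 _).comp
    (measurable_pi_lambda _ fun i => measurable_hamiltonianSK B (r i))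

theorem quenchedLog_eq (hB : Summable fun p : ℕ+ => (2 : ℝ) ^ (p : ℕ) * B p ^ 2)
    (h : Fin N → ℝ) :
    quenchedLog B h = ∫ x, logSumExp (fun σ : Config N => ∑ i, h i * spin σ i) x
      ∂multivariateGaussian 0 (covSK B id) := by
  rw [← (map_hamiltonianSK hB id).2, integral_map (measurable_toLp_hamiltonianSK B id).aemeasurable
    (continuous_logSumExp _).aestronglyMeasurable]
  rfl

theorem integrable_log_partitionSK (hB : Summable fun p : ℕ+ => (2 : ℝ) ^ (p : ℕ) * B p ^ 2)
    (h : Fin N → ℝ) : Integrable (fun g => Real.log (partitionSK B g h)) (couplingLaw N) := by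
  have h1 := integrable_logSumExp (fun σ : Config N => ∑ i, h i * spin σ i) (covSK B id)
  rw [← (map_hamiltonianSK hB id).2, integrable_map_measure
    (continuous_logSumExp _).aestronglyMeasurable
    (measurable_toLp_hamiltonianSK B id).aemeasurable] at h1
  exact h1

theorem integrable_hamiltonianSK (hB : Summable fun p : ℕ+ => (2 : ℝ) ^ (p : ℕ) * B p ^ 2)
    (σ : Config N) : Integrable (fun g => hamiltonianSK B g σ) (couplingLaw N) := by
  have h1 := integrable_eval_multivariateGaussian (covSK B (id : Config N → Config N)) σ
  rw [← (map_hamiltonianSK hB id).2, integrable_map_measure (by fun_prop)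
    (measurable_toLp_hamiltonianSK B id).aemeasurable] at h1
  exact h1

/-- Superadditivity of the free energy at fixed external fields. -/
theorem quenchedLog_add_le (hB : Summable fun p : ℕ+ => (2 : ℝ) ^ (p : ℕ) * B p ^ 2)
    (h : Fin N → ℝ) (h' : Fin M → ℝ) :
    quenchedLog B h + quenchedLog B h' ≤ quenchedLog B (Fin.append h h') := by
  let r : Config (N + M) → Config N := fun σ i => σ (Fin.castAdd M i)
  let r' : Config (N + M) → Config M := fun σ i => σ (Fin.natAdd N i)
  let a : Config (N + M) → ℝ := fun σ => ∑ i, Fin.append h h' i * spin σ i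
  have ha : ∀ σ, a σ = ∑ i, h i * spin (r σ) i + ∑ i, h' i * spin (r' σ) i := by
    intro σ
    simp only [a, Fin.sum_univ_add, Fin.append_left, Fin.append_right]
    rfl
  obtain ⟨hS', hlaw⟩ := map_hamiltonianSK_add hB r r'
  have hcomp := integral_logSumExp_anti a (map_hamiltonianSK hB (id : Config (N + M) → _)).1 hS'
    (fun σ => ?_) (fun σ τ => add_mul_xi_overlap_le hB σ τ)
  · rw [← hlaw, ← quenchedLog_eq hB] at hcomp
    have hm : Measurable fun g : (CouplingIndex N → ℝ) × (CouplingIndex M → ℝ) =>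
        WithLp.toLp 2 fun σ => hamiltonianSK B g.1 (r σ) + hamiltonianSK B g.2 (r' σ) :=
      (WithLp.measurable_toLp 2 _).comp (measurable_pi_lambda _ fun σ =>
        ((measurable_hamiltonianSK B (r σ)).comp measurable_fst).add
          ((measurable_hamiltonianSK B (r' σ)).comp measurable_snd))
    rw [integral_map hm.aemeasurable (continuous_logSumExp _).aestronglyMeasurable] at hcomp
    refine le_trans (le_of_eq ?_) hcomp
    -- Without interaction between the blocks the partition function factorizes, so its logarithm
    -- splits.
    have hprod : ∀ g : (CouplingIndex N → ℝ) × (CouplingIndex M → ℝ),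
        logSumExp a (WithLp.toLp 2 fun σ => hamiltonianSK B g.1 (r σ) + hamiltonianSK B g.2 (r' σ))
        = Real.log (partitionSK B g.1 h) + Real.log (partitionSK B g.2 h') := by
      intro g
      have h1 : 0 < partitionSK B g.1 h := sum_exp_pos _
      have h2 : 0 < partitionSK B g.2 h' := sum_exp_pos _
      rw [← Real.log_mul h1.ne' h2.ne', logSumExp, partitionSK, partitionSK, Finset.sum_mul_sum,
        ← Fintype.sum_prod_type', ← (Fin.appendEquiv N M).sum_comp]
      congr 1
      refine Finset.sum_congr rfl fun p _ => ?_
      have e1 : r (Fin.append p.1 p.2) = p.1 := by ext i; simp [r]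
      have e2 : r' (Fin.append p.1 p.2) = p.2 := by ext i; simp [r']
      have e3 : (Fin.appendEquiv N M) p = Fin.append p.1 p.2 := rfl
      rw [← Real.exp_add, e3, ha]
      simp only [e1, e2]
      congr 1
      ring
    simp_rw [hprod]
    rw [integral_add ((integrable_log_partitionSK hB h).comp_fst _)
      ((integrable_log_partitionSK hB h').comp_snd _), integral_fun_fst
      (f := fun g => Real.log (partitionSK B g h)), integral_fun_snd
      (f := fun g => Real.log (partitionSK B g h'))]
    simp [quenchedLog]
  · change ((N + M : ℕ) : ℝ) * xi B (overlap σ σ) = N * xi B (overlap (r σ) (r σ)) +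
      M * xi B (overlap (r' σ) (r' σ))
    rw [natCast_mul_xi_overlap_self, natCast_mul_xi_overlap_self, natCast_mul_xi_overlap_self]
    push_cast
    ring

theorem log_sum_exp_field (h : Fin N → ℝ) :
    Real.log (∑ σ : Config N, Real.exp (∑ i, h i * spin σ i))
      = ∑ i, Real.log (2 * Real.cosh (h i)) := by
  have h1 : ∑ σ : Config N, Real.exp (∑ i, h i * spin σ i) = ∏ i, (2 * Real.cosh (h i)) := by
    have h2 : ∀ i, 2 * Real.cosh (h i) = ∑ u : ℤˣ, Real.exp (h i * ((u : ℤ) : ℝ)) := by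
      intro i
      rw [UnitsInt.univ, Finset.sum_pair (by decide), Real.cosh_eq]
      simp
      ring
    simp_rw [h2, Finset.prod_univ_sum, Fintype.piFinset_univ, Real.exp_sum]
    rfl
  rw [h1, Real.log_prod fun i _ => by have := Real.cosh_pos (h i); positivity]

theorem le_quenchedLog (hB : Summable fun p : ℕ+ => (2 : ℝ) ^ (p : ℕ) * B p ^ 2)
    (h : Fin N → ℝ) : ∑ i, Real.log (2 * Real.cosh (h i)) ≤ quenchedLog B h := by
  rw [quenchedLog_eq hB, ← log_sum_exp_field]
  exact log_sum_exp_le_integral_logSumExp _ _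

theorem quenchedLog_le (hB : Summable fun p : ℕ+ => (2 : ℝ) ^ (p : ℕ) * B p ^ 2)
    (h : Fin N → ℝ) :
    quenchedLog B h ≤ ∑ i, Real.log (2 * Real.cosh (h i)) + N * xi B 1 / 2 := by
  rw [quenchedLog_eq hB, ← log_sum_exp_field]
  exact integral_logSumExp_le _ (map_hamiltonianSK hB id).1
    fun σ => natCast_mul_xi_overlap_self B σ

theorem log_two_mul_cosh_le (x : ℝ) : |Real.log (2 * Real.cosh x)| ≤ Real.log 2 + |x| := by
  have h1 : Real.cosh x ≤ Real.exp |x| := by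
    rw [← Real.cosh_abs, Real.cosh_eq]
    have : Real.exp (-|x|) ≤ Real.exp |x| :=
      Real.exp_le_exp.2 (by linarith [abs_nonneg x])
    linarith
  have h2 := Real.one_le_cosh x
  rw [abs_of_nonneg (Real.log_nonneg (by linarith)), Real.log_mul two_ne_zero (Real.cosh_pos x).ne']
  have h3 := Real.log_le_log (Real.cosh_pos x) h1
  rw [Real.log_exp] at h3
  linarith

theorem continuous_log_two_mul_cosh : Continuous fun x : ℝ => Real.log (2 * Real.cosh x) :=
  (continuous_const.mul Real.continuous_cosh).log fun x => by
    exact mul_ne_zero two_ne_zero (Real.cosh_pos x).ne'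

theorem integrable_log_two_mul_cosh {ν : Measure ℝ} [IsProbabilityMeasure ν]
    (hν : Integrable (fun x => x) ν) : Integrable (fun x => Real.log (2 * Real.cosh x)) ν :=
  Integrable.mono' ((integrable_const (Real.log 2)).add hν.abs)
    continuous_log_two_mul_cosh.aestronglyMeasurable (ae_of_all _ log_two_mul_cosh_le)

section FreeEnergy

variable {ν : Measure ℝ} [IsProbabilityMeasure ν]

theorem integrable_log_partitionSK_prod
    (hB : Summable fun p : ℕ+ => (2 : ℝ) ^ (p : ℕ) * B p ^ 2)
    (hν : Integrable (fun x => x) ν) (N : ℕ) :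
    Integrable (fun w : (CouplingIndex N → ℝ) × (Fin N → ℝ) => Real.log (partitionSK B w.1 w.2))
      ((couplingLaw N).prod (Measure.pi fun _ : Fin N => ν)) := by
  have hm : Measurable fun w : (CouplingIndex N → ℝ) × (Fin N → ℝ) => partitionSK B w.1 w.2 := by
    unfold partitionSK
    refine Finset.measurable_sum _ fun σ _ => Real.measurable_exp.comp ?_
    refine ((measurable_hamiltonianSK B σ).comp measurable_fst).add ?_
    fun_prop
  have hi1 : Integrable (fun w : (CouplingIndex N → ℝ) × (Fin N → ℝ) =>
      ∑ σ, |hamiltonianSK B w.1 σ|) ((couplingLaw N).prod (Measure.pi fun _ : Fin N => ν)) :=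
    integrable_finsetSum _ fun σ _ => ((integrable_hamiltonianSK hB σ).comp_fst _).abs
  have hi2 : Integrable (fun w : (CouplingIndex N → ℝ) × (Fin N → ℝ) =>
      ∑ i, |w.2 i|) ((couplingLaw N).prod (Measure.pi fun _ : Fin N => ν)) :=
    integrable_finsetSum _ fun i _ => ((integrable_eval (i := i) hν).comp_snd _).abs
  refine Integrable.mono' ((integrable_const |Real.log (∑ _σ : Config N, Real.exp 0)|).add
    (hi1.add hi2)) hm.log.aestronglyMeasurable (ae_of_all _ fun w => ?_)
  -- A bound on all exponents at once; the logarithm then differs from its value at zero exponents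
  -- by at most this integrable quantity.
  set C := ∑ σ : Config N, |hamiltonianSK B w.1 σ| + ∑ i, |w.2 i| with hC
  have hle : ∀ σ : Config N, |hamiltonianSK B w.1 σ + ∑ i, w.2 i * spin σ i| ≤ C := by
    intro σ
    refine (abs_add_le _ _).trans (add_le_add ?_ ?_)
    · exact Finset.single_le_sum (f := fun σ => |hamiltonianSK B w.1 σ|)
        (fun _ _ => abs_nonneg _) (Finset.mem_univ σ)
    · refine (Finset.abs_sum_le_sum_abs _ _).trans (Finset.sum_le_sum fun i _ => ?_)
      rw [abs_mul, abs_spin, mul_one]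
  have h1 : Real.log (partitionSK B w.1 w.2) ≤ Real.log (∑ _σ : Config N, Real.exp 0) + C :=
    log_sum_exp_le_add fun σ => by linarith [(abs_le.1 (hle σ)).2]
  have h2 : Real.log (∑ _σ : Config N, Real.exp 0) ≤ Real.log (partitionSK B w.1 w.2) + C :=
    log_sum_exp_le_add fun σ => by linarith [(abs_le.1 (hle σ)).1]
  change |Real.log (partitionSK B w.1 w.2)| ≤ |Real.log (∑ _σ : Config N, Real.exp 0)| + C
  rw [abs_le]
  constructor
  · linarith [neg_abs_le (Real.log (∑ _σ : Config N, Real.exp 0))]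
  · linarith [le_abs_self (Real.log (∑ _σ : Config N, Real.exp 0))]

theorem integrable_quenchedLog (hB : Summable fun p : ℕ+ => (2 : ℝ) ^ (p : ℕ) * B p ^ 2)
    (hν : Integrable (fun x => x) ν) (N : ℕ) :
    Integrable (fun h : Fin N → ℝ => quenchedLog B h) (Measure.pi fun _ => ν) :=
  (integrable_log_partitionSK_prod hB hν N).integral_prod_right

theorem finiteFreeEnergySK_eq (hB : Summable fun p : ℕ+ => (2 : ℝ) ^ (p : ℕ) * B p ^ 2)
    (hν : Integrable (fun x => x) ν) (N : ℕ) :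
    finiteFreeEnergySK N B ν = (∫ h : Fin N → ℝ, quenchedLog B h ∂Measure.pi fun _ => ν) / N := by
  rw [finiteFreeEnergySK, integral_prod_symm _ (integrable_log_partitionSK_prod hB hν N),
    div_eq_inv_mul]
  rfl

theorem integral_quenchedLog_superadditive
    (hB : Summable fun p : ℕ+ => (2 : ℝ) ^ (p : ℕ) * B p ^ 2)
    (hν : Integrable (fun x => x) ν) (N M : ℕ) :
    (∫ h : Fin N → ℝ, quenchedLog B h ∂Measure.pi fun _ => ν) +
      (∫ h : Fin M → ℝ, quenchedLog B h ∂Measure.pi fun _ => ν) ≤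
      ∫ h : Fin (N + M) → ℝ, quenchedLog B h ∂Measure.pi fun _ => ν := by
  have hmp := measurePreserving_finAppend ν N M
  have hN := integrable_quenchedLog hB hν N
  have hM := integrable_quenchedLog hB hν M
  have hNM := integrable_quenchedLog hB hν (N + M)
  rw [← hmp.map_eq] at hNM ⊢
  rw [integral_map hmp.measurable.aemeasurable hNM.1]
  rw [integrable_map_measure hNM.1 hmp.measurable.aemeasurable] at hNM
  have h := integral_mono ((hN.comp_fst (Measure.pi fun _ : Fin M => ν)).add
    (hM.comp_snd (Measure.pi fun _ : Fin N => ν))) hNM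
    (fun p => quenchedLog_add_le hB p.1 p.2)
  refine le_trans (le_of_eq ?_) h
  simp only [Pi.add_apply]
  rw [integral_add (hN.comp_fst _) (hM.comp_snd _),
    integral_fun_fst (f := fun h : Fin N → ℝ => quenchedLog B h),
    integral_fun_snd (f := fun h : Fin M → ℝ => quenchedLog B h)]
  simp

theorem integral_sum_log_cosh (hν : Integrable (fun x => x) ν) (N : ℕ) :
    Integrable (fun h : Fin N → ℝ => ∑ i, Real.log (2 * Real.cosh (h i)))
      (Measure.pi fun _ => ν) ∧
    ∫ h : Fin N → ℝ, ∑ i, Real.log (2 * Real.cosh (h i)) ∂Measure.pi (fun _ => ν)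
      = N * ∫ x, Real.log (2 * Real.cosh x) ∂ν := by
  have hi := integrable_log_two_mul_cosh hν
  have hi' : ∀ i : Fin N, Integrable (fun h : Fin N → ℝ => Real.log (2 * Real.cosh (h i)))
      (Measure.pi fun _ => ν) := fun i =>
    (measurePreserving_eval (fun _ : Fin N => ν) i).integrable_comp_of_integrable hi
  refine ⟨integrable_finsetSum _ fun i _ => hi' i, ?_⟩
  rw [integral_finsetSum _ fun i _ => hi' i]
  have : ∀ i : Fin N, ∫ h : Fin N → ℝ, Real.log (2 * Real.cosh (h i)) ∂Measure.pi (fun _ => ν)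
      = ∫ x, Real.log (2 * Real.cosh x) ∂ν := by
    intro i
    have hmp := measurePreserving_eval (fun _ : Fin N => ν) i
    rw [← hmp.map_eq, integral_map hmp.measurable.aemeasurable
      continuous_log_two_mul_cosh.aestronglyMeasurable]
    simp only [hmp.map_eq]
  simp [this]

theorem finiteFreeEnergySK_bounds (hB : Summable fun p : ℕ+ => (2 : ℝ) ^ (p : ℕ) * B p ^ 2)
    (hν : Integrable (fun x => x) ν) (hN : N ≠ 0) :
    ∫ x, Real.log (2 * Real.cosh x) ∂ν ≤ finiteFreeEnergySK N B ν ∧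
      finiteFreeEnergySK N B ν ≤ ∫ x, Real.log (2 * Real.cosh x) ∂ν + xi B 1 / 2 := by
  have hpos : (0 : ℝ) < N := by exact_mod_cast Nat.pos_of_ne_zero hN
  obtain ⟨hi, he⟩ := integral_sum_log_cosh (ν := ν) hν N
  rw [finiteFreeEnergySK_eq hB hν, le_div_iff₀ hpos, div_le_iff₀ hpos]
  constructor
  · have := integral_mono hi (integrable_quenchedLog hB hν N) (le_quenchedLog hB)
    rw [he] at this
    linarith
  · have := integral_mono (integrable_quenchedLog hB hν N) (hi.add (integrable_const _))
      (quenchedLog_le hB)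
    simp only [Pi.add_apply] at this
    rw [integral_add hi (integrable_const _), he] at this
    simp only [integral_const, probReal_univ, one_smul] at this
    linarith

/-- The thermodynamic limit of the free energy exists. -/
theorem tendsto_finiteFreeEnergySK (hB : Summable fun p : ℕ+ => (2 : ℝ) ^ (p : ℕ) * B p ^ 2)
    (hν : Integrable (fun x => x) ν) :
    Tendsto (fun N => finiteFreeEnergySK N B ν) atTop (𝓝 (freeEnergySK B ν)) := by
  -- The sign turns superadditivity into the subadditivity of Fekete's lemma.
  let u : ℕ → ℝ := fun N => -∫ h : Fin N → ℝ, quenchedLog B h ∂Measure.pi fun _ => ν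
  have hsub : Subadditive u := fun m n => by
    have := integral_quenchedLog_superadditive hB hν m n
    simp only [u]
    linarith
  have hbdd : BddBelow (Set.range fun n => u n / n) := by
    -- The `0` accounts for `n = 0`, where the quotient is `0` by convention.
    refine ⟨min 0 (-(∫ x, Real.log (2 * Real.cosh x) ∂ν + xi B 1 / 2)), ?_⟩
    rintro _ ⟨n, rfl⟩
    rcases eq_or_ne n 0 with rfl | hn
    · simp
    · have h1 := (finiteFreeEnergySK_bounds hB hν hn).2
      rw [finiteFreeEnergySK_eq hB hν] at h1
      refine (min_le_right _ _).trans ?_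
      simp only [u, neg_div]
      linarith
  have hlim := (hsub.tendsto_lim hbdd).neg
  have heq : (fun n => -(u n / n)) = fun N => finiteFreeEnergySK N B ν := by
    ext n
    rw [finiteFreeEnergySK_eq hB hν]
    simp only [u, neg_div, neg_neg]
  rw [heq] at hlim
  rw [freeEnergySK, hlim.limUnder_eq]
  exact hlim

theorem freeEnergySK_bounds (hB : Summable fun p : ℕ+ => (2 : ℝ) ^ (p : ℕ) * B p ^ 2)
    (hν : Integrable (fun x => x) ν) :
    ∫ x, Real.log (2 * Real.cosh x) ∂ν ≤ freeEnergySK B ν ∧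
      freeEnergySK B ν ≤ ∫ x, Real.log (2 * Real.cosh x) ∂ν + xi B 1 / 2 := by
  have h := tendsto_finiteFreeEnergySK hB hν
  have hb : ∀ᶠ N : ℕ in atTop, N ≠ 0 := eventually_ne_atTop 0
  exact ⟨ge_of_tendsto h (hb.mono fun N hN => (finiteFreeEnergySK_bounds hB hν hN).1),
    le_of_tendsto h (hb.mono fun N hN => (finiteFreeEnergySK_bounds hB hν hN).2)⟩

/-- Without couplings `ξ(1) = 0` and the two sides of the sandwich coincide. -/
theorem freeEnergySK_zero (hν : Integrable (fun x => x) ν) :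
    freeEnergySK 0 ν = ∫ x, Real.log (2 * Real.cosh x) ∂ν := by
  have h := freeEnergySK_bounds (B := 0) (by simp) hν
  have h0 : xi 0 1 = 0 := by simp [xi]
  rw [h0] at h
  linarith [h.1, h.2]

end FreeEnergy

end SKFI

/-! ### Hyperbolic functions and their Gaussian averages. -/

theorem abs_tanh_le_one (x : ℝ) : |Real.tanh x| ≤ 1 :=
  abs_le.2 ⟨(Real.neg_one_lt_tanh x).le, (Real.tanh_lt_one x).le⟩

theorem hasDerivAt_tanh_real (x : ℝ) : HasDerivAt Real.tanh (1 / Real.cosh x ^ 2) x := by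
  have h := (Real.hasDerivAt_sinh x).div (Real.hasDerivAt_cosh x) (Real.cosh_pos x).ne'
  have he : Real.tanh = Real.sinh / Real.cosh := funext Real.tanh_eq_sinh_div_cosh
  rw [he]
  refine h.congr_deriv ?_
  congr 1
  linarith [Real.cosh_sq x]

theorem hasDerivAt_log_two_mul_cosh (x : ℝ) :
    HasDerivAt (fun x => Real.log (2 * Real.cosh x)) (Real.tanh x) x := by
  have h := ((Real.hasDerivAt_cosh x).const_mul 2).log
    (mul_ne_zero two_ne_zero (Real.cosh_pos x).ne')
  refine h.congr_deriv ?_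
  rw [Real.tanh_eq_sinh_div_cosh, mul_div_mul_left _ _ two_ne_zero]

theorem hasDerivAt_one_div_cosh_sq (x : ℝ) :
    HasDerivAt (fun x => 1 / Real.cosh x ^ 2) (-(2 * Real.tanh x / Real.cosh x ^ 2)) x := by
  have hc := (Real.cosh_pos x).ne'
  have h := ((Real.hasDerivAt_cosh x).pow 2).inv (pow_ne_zero 2 hc)
  simp only [one_div]
  refine h.congr_deriv ?_
  rw [Real.tanh_eq_sinh_div_cosh]
  simp only [Pi.pow_apply]
  field_simp
  norm_num
  ring

theorem one_div_cosh_sq_le_one (x : ℝ) : 1 / Real.cosh x ^ 2 ≤ 1 := by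
  refine div_le_one_of_le₀ (one_le_pow₀ (Real.one_le_cosh x)) (by positivity)

theorem continuous_tanh_real : Continuous Real.tanh :=
  continuous_iff_continuousAt.2 fun x => (hasDerivAt_tanh_real x).continuousAt

theorem continuous_one_div_cosh_sq : Continuous fun x => 1 / Real.cosh x ^ 2 :=
  continuous_iff_continuousAt.2 fun x => (hasDerivAt_one_div_cosh_sq x).continuousAt

theorem strictMono_tanh_real : StrictMono Real.tanh :=
  strictMono_of_deriv_pos fun x => by
    rw [(hasDerivAt_tanh_real x).deriv]
    have := Real.cosh_pos x
    positivity

theorem tendsto_tanh_atTop_one : Tendsto Real.tanh atTop (𝓝 1) := by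
  -- Indeed `1 - tanh x = exp (-x) / cosh x` and `cosh x ≥ 1`.
  have hlow : ∀ x, 1 - Real.exp (-x) ≤ Real.tanh x := by
    intro x
    rw [Real.tanh_eq_sinh_div_cosh, le_div_iff₀ (Real.cosh_pos x)]
    have h1 := Real.cosh_sub_sinh x
    nlinarith [Real.one_le_cosh x, Real.exp_pos (-x)]
  have hlim : Tendsto (fun x : ℝ => 1 - Real.exp (-x)) atTop (𝓝 1) := by
    simpa using tendsto_const_nhds.sub Real.tendsto_exp_neg_atTop_nhds_zero
  exact tendsto_of_tendsto_of_tendsto_of_le_of_le hlim tendsto_const_nhds hlow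
    fun x => (abs_le.1 (abs_tanh_le_one x)).2

/-- Differentiation of a translation average with bounded derivative. -/
theorem hasDerivAt_integral_comp_add {μ : Measure ℝ} [IsFiniteMeasure μ] {f f' : ℝ → ℝ}
    (hf : ∀ x, HasDerivAt f (f' x) x) {K : ℝ} (hK : ∀ x, |f' x| ≤ K)
    (hi : ∀ x, Integrable (fun y => f (x + y)) μ) (x : ℝ) :
    HasDerivAt (fun x => ∫ y, f (x + y) ∂μ) (∫ y, f' (x + y) ∂μ) x := by
  have hfc : Continuous f := continuous_iff_continuousAt.2 fun x => (hf x).continuousAt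
  have hf' : Measurable f' := by
    have : f' = deriv f := funext fun x => (hf x).deriv.symm
    exact this ▸ measurable_deriv f
  refine (hasDerivAt_integral_of_dominated_loc_of_deriv_le (F := fun x y => f (x + y))
    (F' := fun x y => f' (x + y)) (bound := fun _ => K) Filter.univ_mem
    (Eventually.of_forall fun x => (hi x).1) (hi x)
    (hf'.comp (measurable_const_add x)).aestronglyMeasurable
    (ae_of_all _ fun y x _ => hK (x + y)) (integrable_const _) (ae_of_all _ fun y x _ => ?_)).2
  exact (hf (x + y)).comp_add_const x y

/-- Averaging a bounded odd function which is positive on the positive axis against a Gaussian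
law with positive mean gives a positive number. -/
theorem integral_comp_add_gaussianReal_pos {g : ℝ → ℝ} (hg : Continuous g) {K : ℝ}
    (hK : ∀ x, |g x| ≤ K) (hodd : ∀ x, g (-x) = -g x) (hpos : ∀ x, 0 < x → 0 < g x) (v : NNReal)
    {x : ℝ} (hx : 0 < x) : 0 < ∫ y, g (x + y) ∂gaussianReal 0 v := by
  have hmap := gaussianReal_map_const_add (μ := 0) (v := v) x
  rw [zero_add] at hmap
  have h1 : ∫ y, g (x + y) ∂gaussianReal 0 v = ∫ y, g y ∂gaussianReal x v := by
    rw [← hmap, integral_map (by fun_prop) hg.aestronglyMeasurable]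
  rw [h1]
  -- A degenerate Gaussian has no density and is treated as a point mass. Otherwise the integral is
  -- folded at the origin: for `y > 0` the density with mean `x > 0` is larger at `y` than at `-y`,
  -- and `g` is odd.
  rcases eq_or_ne v 0 with rfl | hv
  · rw [gaussianReal_zero_var, integral_dirac]
    exact hpos x hx
  · rw [integral_gaussianReal_eq_integral_smul hv]
    simp only [smul_eq_mul]
    have hi : Integrable fun y => gaussianPDFReal x v y * g y := by
      have := (integrable_gaussianPDFReal x v).bdd_mul hg.aestronglyMeasurable (ae_of_all _ hK)
      exact this.congr (ae_of_all _ fun y => mul_comm _ _)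
    have hi' := hi.comp_neg
    have h2 : 2 * ∫ y, gaussianPDFReal x v y * g y
        = ∫ y, (gaussianPDFReal x v y - gaussianPDFReal x v (-y)) * g y := by
      have e : ∀ y, (gaussianPDFReal x v y - gaussianPDFReal x v (-y)) * g y =
          gaussianPDFReal x v y * g y + gaussianPDFReal x v (-y) * g (-y) := fun y => by
        rw [hodd]; ring
      simp_rw [e]
      rw [integral_add hi hi', integral_neg_eq_self (fun y => gaussianPDFReal x v y * g y)]
      ring
    have hi'' : Integrable fun y => (gaussianPDFReal x v y - gaussianPDFReal x v (-y)) * g y := by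
      refine (hi.add hi').congr (ae_of_all _ fun y => ?_)
      simp only [Pi.add_apply, hodd]
      ring
    have hlt : ∀ y, 0 < y → gaussianPDFReal x v (-y) < gaussianPDFReal x v y := by
      intro y hy
      have hv' : (0 : ℝ) < v := by positivity
      simp only [gaussianPDFReal]
      refine mul_lt_mul_of_pos_left (Real.exp_lt_exp.2 ?_) (by positivity)
      refine div_lt_div_of_pos_right ?_ (by positivity)
      nlinarith [mul_pos hx hy]
    have hpos' : ∀ y, 0 < y →
        0 < (gaussianPDFReal x v y - gaussianPDFReal x v (-y)) * g y := fun y hy =>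
      mul_pos (sub_pos.2 (hlt y hy)) (hpos y hy)
    have hnn : ∀ y, 0 ≤ (gaussianPDFReal x v y - gaussianPDFReal x v (-y)) * g y := by
      intro y
      rcases lt_trichotomy y 0 with hy | rfl | hy
      · have := hpos' (-y) (by linarith)
        rw [neg_neg, hodd] at this
        nlinarith
      · simp
      · exact (hpos' y hy).le
    have h3 : 0 < ∫ y, (gaussianPDFReal x v y - gaussianPDFReal x v (-y)) * g y := by
      rw [integral_pos_iff_support_of_nonneg hnn hi'']
      refine lt_of_lt_of_le ?_ (measure_mono (s := Set.Ioi 0) fun y hy => (hpos' y hy).ne')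
      simp
    linarith

/-! ### Concavity of the averaged hyperbolic tangent. -/

section CurieWeiss

variable (v : NNReal)

/-- `x ↦ 𝔼 tanh (x + h)` for a centered Gaussian `h` of variance `v`. -/
noncomputable def meanTanh (x : ℝ) : ℝ := ∫ y, Real.tanh (x + y) ∂gaussianReal 0 v

/-- `x ↦ 𝔼 log (2 cosh (x + h))` for a centered Gaussian `h` of variance `v`. -/
noncomputable def meanLogCosh (x : ℝ) : ℝ :=
  ∫ y, Real.log (2 * Real.cosh (x + y)) ∂gaussianReal 0 v

theorem integral_comp_neg_gaussianReal_zero (f : ℝ → ℝ) :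
    ∫ y, f (-y) ∂gaussianReal 0 v = ∫ y, f y ∂gaussianReal 0 v := by
  have h := gaussianReal_map_neg (μ := 0) (v := v)
  rw [neg_zero] at h
  nth_rewrite 2 [← h]
  exact ((MeasurableEquiv.neg ℝ).measurableEmbedding.integral_map f).symm

theorem integrable_comp_add_gaussianReal {f : ℝ → ℝ} (hf : Continuous f) {K : ℝ}
    (hK : ∀ x, |f x| ≤ K) (x : ℝ) : Integrable (fun y => f (x + y)) (gaussianReal 0 v) :=
  Integrable.of_bound (hf.comp (continuous_const_add x)).aestronglyMeasurable K
    (ae_of_all _ fun y => hK (x + y))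

theorem hasDerivAt_meanLogCosh (x : ℝ) : HasDerivAt (meanLogCosh v) (meanTanh v x) x := by
  refine hasDerivAt_integral_comp_add hasDerivAt_log_two_mul_cosh abs_tanh_le_one (fun x => ?_) x
  have hid : Integrable (fun y : ℝ => y) (gaussianReal 0 v) := IsGaussian.integrable_fun_id
  refine Integrable.mono' ((integrable_const (Real.log 2)).add (((integrable_const x).add hid).abs))
    (SKFI.continuous_log_two_mul_cosh.comp (continuous_const_add x)).aestronglyMeasurable
    (ae_of_all _ fun y => SKFI.log_two_mul_cosh_le (x + y))

theorem hasDerivAt_meanTanh (x : ℝ) :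
    HasDerivAt (meanTanh v) (∫ y, 1 / Real.cosh (x + y) ^ 2 ∂gaussianReal 0 v) x := by
  refine hasDerivAt_integral_comp_add (f' := fun x => 1 / Real.cosh x ^ 2) hasDerivAt_tanh_real
    (K := 1) (fun x => ?_)
    (fun x => integrable_comp_add_gaussianReal v continuous_tanh_real abs_tanh_le_one x) x
  rw [abs_of_nonneg (by positivity)]
  exact one_div_cosh_sq_le_one x

theorem abs_two_mul_tanh_div_cosh_sq_le (x : ℝ) :
    |2 * Real.tanh x / Real.cosh x ^ 2| ≤ 2 := by
  rw [div_eq_mul_one_div, abs_mul, abs_mul, abs_two,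
    abs_of_nonneg (by positivity : 0 ≤ 1 / Real.cosh x ^ 2)]
  have h1 := abs_tanh_le_one x
  have h2 := one_div_cosh_sq_le_one x
  calc 2 * |Real.tanh x| * (1 / Real.cosh x ^ 2) ≤ 2 * 1 * 1 := by gcongr
    _ = 2 := by norm_num

theorem hasDerivAt_integral_one_div_cosh_sq (x : ℝ) :
    HasDerivAt (fun x => ∫ y, 1 / Real.cosh (x + y) ^ 2 ∂gaussianReal 0 v)
      (∫ y, -(2 * Real.tanh (x + y) / Real.cosh (x + y) ^ 2) ∂gaussianReal 0 v) x := by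
  refine hasDerivAt_integral_comp_add (f := fun x => 1 / Real.cosh x ^ 2)
    (f' := fun x => -(2 * Real.tanh x / Real.cosh x ^ 2)) hasDerivAt_one_div_cosh_sq
    (K := 2) (fun x => ?_)
    (fun x => integrable_comp_add_gaussianReal v continuous_one_div_cosh_sq (K := 1)
      (fun x => ?_) x) x
  · rw [abs_neg]
    exact abs_two_mul_tanh_div_cosh_sq_le x
  · rw [abs_of_nonneg (by positivity)]
    exact one_div_cosh_sq_le_one x

/-- The derivative is minus the average of `2 tanh / cosh²`, a bounded odd function positive on the
positive axis, so the folding argument applies. Strict concavity of `meanTanh` follows. -/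
theorem strictAntiOn_integral_one_div_cosh_sq :
    StrictAntiOn (fun x => ∫ y, 1 / Real.cosh (x + y) ^ 2 ∂gaussianReal 0 v) (Set.Ici 0) := by
  refine strictAntiOn_of_deriv_neg (convex_Ici 0)
    (fun x _ => (hasDerivAt_integral_one_div_cosh_sq v x).continuousAt.continuousWithinAt)
    fun x hx => ?_
  rw [interior_Ici] at hx
  rw [(hasDerivAt_integral_one_div_cosh_sq v x).deriv, integral_neg, neg_lt_zero]
  refine integral_comp_add_gaussianReal_pos (g := fun x => 2 * Real.tanh x / Real.cosh x ^ 2)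
    ((continuous_const.mul continuous_tanh_real).div (Real.continuous_cosh.pow 2)
      fun x => (pow_pos (Real.cosh_pos x) 2).ne') abs_two_mul_tanh_div_cosh_sq_le
    (fun x => by rw [Real.tanh_neg, Real.cosh_neg]; ring) (fun x hx => ?_) v hx
  have h1 : 0 < Real.tanh x := by simpa using strictMono_tanh_real hx
  have h2 := Real.cosh_pos x
  positivity

theorem continuous_meanTanh : Continuous (meanTanh v) :=
  continuous_iff_continuousAt.2 fun x => (hasDerivAt_meanTanh v x).continuousAt

theorem meanTanh_zero : meanTanh v 0 = 0 := by
  have h := integral_comp_neg_gaussianReal_zero v Real.tanh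
  simp only [Real.tanh_neg, integral_neg] at h
  simp only [meanTanh, zero_add]
  linarith

theorem strictConcaveOn_meanTanh : StrictConcaveOn ℝ (Set.Ici 0) (meanTanh v) := by
  refine StrictAntiOn.strictConcaveOn_of_deriv (convex_Ici 0)
    (continuous_meanTanh v).continuousOn ?_
  have : deriv (meanTanh v) = fun x => ∫ y, 1 / Real.cosh (x + y) ^ 2 ∂gaussianReal 0 v :=
    funext fun x => (hasDerivAt_meanTanh v x).deriv
  rw [this, interior_Ici]
  exact (strictAntiOn_integral_one_div_cosh_sq v).mono Set.Ioi_subset_Ici_self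

/-- `meanTanh v x / x` is strictly decreasing. -/
theorem meanTanh_mul_lt {x y : ℝ} (hx : 0 < x) (hxy : x < y) :
    meanTanh v y * x < meanTanh v x * y := by
  have hy : 0 < y := hx.trans hxy
  have ha : 0 < x / y := by positivity
  have hb : 0 < 1 - x / y := by rw [sub_pos, div_lt_one hy]; exact hxy
  -- Strict concavity at `x`, seen as a convex combination of `y` and of `0`, where the function
  -- vanishes.
  have h := (strictConcaveOn_meanTanh v).2 (Set.mem_Ici.2 hy.le) (Set.mem_Ici.2 le_rfl) hy.ne'
    ha hb (by ring)
  simp only [smul_eq_mul, meanTanh_zero, mul_zero, add_zero, div_mul_cancel₀ _ hy.ne'] at h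
  rw [div_mul_eq_mul_div, div_lt_iff₀ hy] at h
  linarith

theorem monotone_meanTanh : Monotone (meanTanh v) := fun x x' hx =>
  integral_mono (integrable_comp_add_gaussianReal v continuous_tanh_real abs_tanh_le_one x)
    (integrable_comp_add_gaussianReal v continuous_tanh_real abs_tanh_le_one x')
    fun y => strictMono_tanh_real.monotone (by simpa using hx)

theorem tendsto_meanTanh_atTop : Tendsto (meanTanh v) atTop (𝓝 1) := by
  have h : Tendsto (meanTanh v) atTop (𝓝 (∫ _, (1 : ℝ) ∂gaussianReal 0 v)) := by
    refine tendsto_integral_filter_of_dominated_convergence (fun _ => 1)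
      (Eventually.of_forall fun x =>
        (continuous_tanh_real.comp (continuous_const_add x)).aestronglyMeasurable)
      (Eventually.of_forall fun x => ae_of_all _ fun y => abs_tanh_le_one (x + y))
      (integrable_const _) (ae_of_all _ fun y => ?_)
    exact tendsto_tanh_atTop_one.comp (tendsto_atTop_add_const_right _ y tendsto_id)
  simpa using h

theorem exists_meanTanh_eq {u : ℝ} (hu0 : 0 < u) (hu1 : u < 1) : ∃ x, 0 < x ∧ meanTanh v x = u := by
  obtain ⟨X, hX, hX0⟩ := (((tendsto_meanTanh_atTop v).eventually (lt_mem_nhds hu1)).and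
    (eventually_ge_atTop 0)).exists
  obtain ⟨x, hx, hxu⟩ := intermediate_value_Icc hX0 (continuous_meanTanh v).continuousOn
    (⟨by rw [meanTanh_zero]; exact hu0.le, hX.le⟩ : u ∈ Set.Icc (meanTanh v 0) (meanTanh v X))
  refine ⟨x, lt_of_le_of_ne hx.1 ?_, hxu⟩
  rintro rfl
  rw [meanTanh_zero] at hxu
  exact hu0.ne hxu

/-- A mean value argument: the derivative decreases from its value `1/α` at the origin. This is what
places `β_u` above `α`. -/
theorem meanTanh_lt_mul {x : ℝ} (hx : 0 < x) :
    meanTanh v x < (∫ y, 1 / Real.cosh y ^ 2 ∂gaussianReal 0 v) * x := by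
  obtain ⟨c, hc, hd⟩ := exists_hasDerivAt_eq_slope (meanTanh v)
    (fun x => ∫ y, 1 / Real.cosh (x + y) ^ 2 ∂gaussianReal 0 v) hx
    (continuous_meanTanh v).continuousOn fun c _ => hasDerivAt_meanTanh v c
  rw [meanTanh_zero, sub_zero, sub_zero, eq_div_iff hx.ne'] at hd
  rw [← hd]
  refine mul_lt_mul_of_pos_right ?_ hx
  have h := strictAntiOn_integral_one_div_cosh_sq v (Set.mem_Ici.2 le_rfl)
    (Set.mem_Ici.2 hc.1.le) hc.1
  simpa using h

theorem integral_one_div_cosh_sq_pos : 0 < ∫ y, 1 / Real.cosh y ^ 2 ∂gaussianReal 0 v := by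
  obtain ⟨x, hx, hxu⟩ := exists_meanTanh_eq v (u := 1 / 2) (by norm_num) (by norm_num)
  have h := meanTanh_lt_mul v hx
  rw [hxu] at h
  exact pos_of_mul_pos_left (by linarith) hx.le

theorem meanLogCosh_neg (x : ℝ) : meanLogCosh v (-x) = meanLogCosh v x := by
  rw [meanLogCosh, meanLogCosh,
    ← integral_comp_neg_gaussianReal_zero v fun y => Real.log (2 * Real.cosh (-x + y))]
  refine integral_congr_ae (ae_of_all _ fun y => ?_)
  simp only
  rw [← neg_add, Real.cosh_neg]

end CurieWeiss

/-! ### The Curie-Weiss maximizer and the conclusion. -/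

namespace SKFI

variable (v : NNReal)

theorem variational_bounds {B : ℕ+ → ℝ}
    (hB : Summable fun p : ℕ+ => (2 : ℝ) ^ (p : ℕ) * B p ^ 2) (β μ : ℝ) :
    cwFun (gaussianReal 0 v) μ β ≤ variational (gaussianReal 0 v) β B μ ∧
      variational (gaussianReal 0 v) β B μ ≤ cwFun (gaussianReal 0 v) μ β + xi B 1 / 2 := by
  rw [cwFun, variational, variational, gaussianReal_map_const_add]
  have hν : Integrable (fun x : ℝ => x) (gaussianReal (0 + β * μ) v) :=
    IsGaussian.integrable_fun_id
  rw [freeEnergySK_zero hν]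
  have h := freeEnergySK_bounds hB hν
  constructor <;> linarith [h.1, h.2]

theorem cwFun_gaussianReal (μ β : ℝ) :
    cwFun (gaussianReal 0 v) μ β = meanLogCosh v (β * μ) - β * μ ^ 2 / 2 := by
  have hν : Integrable (fun x : ℝ => x) (gaussianReal (0 + β * μ) v) :=
    IsGaussian.integrable_fun_id
  rw [cwFun, variational, gaussianReal_map_const_add, freeEnergySK_zero hν, meanLogCosh,
    ← gaussianReal_map_const_add, integral_map (by fun_prop)
      continuous_log_two_mul_cosh.aestronglyMeasurable]

theorem cwFun_abs (μ β : ℝ) :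
    cwFun (gaussianReal 0 v) |μ| β = cwFun (gaussianReal 0 v) μ β := by
  rcases abs_choice μ with h | h <;> rw [h]
  rw [cwFun_gaussianReal, cwFun_gaussianReal, mul_neg, meanLogCosh_neg, neg_sq]

theorem hasDerivAt_cwFun (β μ : ℝ) :
    HasDerivAt (fun μ => cwFun (gaussianReal 0 v) μ β) (β * (meanTanh v (β * μ) - μ)) μ := by
  simp only [cwFun_gaussianReal]
  have h1 := (hasDerivAt_meanLogCosh v (β * μ)).comp μ ((hasDerivAt_id μ).const_mul β)
  have h2 := (((hasDerivAt_pow 2 μ).const_mul β).div_const 2)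
  refine (h1.sub h2).congr_deriv ?_
  simp
  ring

theorem continuous_cwFun (β : ℝ) : Continuous fun μ => cwFun (gaussianReal 0 v) μ β :=
  continuous_iff_continuousAt.2 fun μ => (hasDerivAt_cwFun v β μ).continuousAt

/-- Compactness supplies a maximizer, so the choice operator returns one; uniqueness plays no role
here. -/
theorem cwMag_spec (β : ℝ) : cwMag (gaussianReal 0 v) β ∈ Set.Icc (0 : ℝ) 1 ∧
    IsMaxOn (fun μ => cwFun (gaussianReal 0 v) μ β) (Set.Icc (0 : ℝ) 1)
      (cwMag (gaussianReal 0 v) β) := by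
  obtain ⟨m, hm⟩ := isCompact_Icc.exists_isMaxOn (Set.nonempty_Icc.2 zero_le_one)
    (continuous_cwFun v β).continuousOn
  exact Classical.epsilon_spec (p := fun μ : ℝ => μ ∈ Set.Icc (0 : ℝ) 1 ∧
    IsMaxOn (fun μ' => cwFun (gaussianReal 0 v) μ' β) (Set.Icc (0 : ℝ) 1) μ) ⟨m, hm⟩

/-- A nonzero solution of the mean field equation is the Curie-Weiss magnetization. -/
theorem cwMag_eq_of_meanTanh_eq {β u : ℝ} (hβ : 0 < β) (hu0 : 0 < u) (hu1 : u ≤ 1)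
    (h : meanTanh v (β * u) = u) : cwMag (gaussianReal 0 v) β = u := by
  obtain ⟨⟨hm0, hm1⟩, hmax⟩ := cwMag_spec v β
  set m := cwMag (gaussianReal 0 v) β
  have hle : cwFun (gaussianReal 0 v) u β ≤ cwFun (gaussianReal 0 v) m β := hmax ⟨hu0.le, hu1⟩
  -- The ratio of `meanTanh v (β x)` to `x` decreases in `x` and equals `1` at `x = u`, so the
  -- derivative is positive before `u` and negative after it.
  have hmono : StrictMonoOn (fun μ => cwFun (gaussianReal 0 v) μ β) (Set.Icc 0 u) := by
    refine strictMonoOn_of_deriv_pos (convex_Icc _ _) (continuous_cwFun v β).continuousOn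
      fun x hx => ?_
    rw [interior_Icc] at hx
    rw [(hasDerivAt_cwFun v β x).deriv]
    refine mul_pos hβ (sub_pos.2 ?_)
    have h1 := meanTanh_mul_lt v (mul_pos hβ hx.1) (mul_lt_mul_of_pos_left hx.2 hβ)
    rw [h] at h1
    have h2 : 0 < β * u := mul_pos hβ hu0
    nlinarith
  have hanti : StrictAntiOn (fun μ => cwFun (gaussianReal 0 v) μ β) (Set.Ici u) := by
    refine strictAntiOn_of_deriv_neg (convex_Ici _) (continuous_cwFun v β).continuousOn
      fun x hx => ?_
    rw [interior_Ici] at hx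
    rw [(hasDerivAt_cwFun v β x).deriv]
    refine mul_neg_of_pos_of_neg hβ (sub_neg.2 ?_)
    have h1 := meanTanh_mul_lt v (mul_pos hβ hu0) (mul_lt_mul_of_pos_left hx hβ)
    rw [h] at h1
    have h2 : 0 < β * u := mul_pos hβ hu0
    nlinarith
  rcases lt_trichotomy m u with hlt | heq | hgt
  · exact absurd (hmono ⟨hm0, hlt.le⟩ ⟨hu0.le, le_rfl⟩ hlt) (not_lt.2 hle)
  · exact heq
  · exact absurd (hanti (Set.mem_Ici.2 le_rfl) (Set.mem_Ici.2 hgt.le) hgt) (not_lt.2 hle)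

theorem betaU_spec {u : ℝ} (hu0 : 0 < u) (hu1 : u < 1) :
    cwAlpha (gaussianReal 0 v) < betaU (gaussianReal 0 v) u ∧
      cwMag (gaussianReal 0 v) (betaU (gaussianReal 0 v) u) = u := by
  obtain ⟨x, hx, hxu⟩ := exists_meanTanh_eq v hu0 hu1
  -- With `meanTanh v x = u`, the choice `β = x / u` makes `u` a solution of the mean field
  -- equation.
  refine Classical.epsilon_spec (p := fun β : ℝ => cwAlpha (gaussianReal 0 v) < β ∧
    cwMag (gaussianReal 0 v) β = u) ⟨x / u, ?_, ?_⟩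
  · have h := meanTanh_lt_mul v hx
    rw [hxu] at h
    rw [cwAlpha, lt_div_iff₀ hu0, inv_mul_lt_iff₀ (integral_one_div_cosh_sq_pos v)]
    exact h
  · refine cwMag_eq_of_meanTanh_eq v (div_pos hx hu0) hu0 hu1.le ?_
    rw [div_mul_cancel₀ _ hu0.ne', hxu]

theorem cwAlpha_pos : 0 < cwAlpha (gaussianReal 0 v) :=
  inv_pos.2 (integral_one_div_cosh_sq_pos v)

/-- At `β_u` the maximizer `u` is interior to `[0, 1]`, hence a critical point. -/
theorem meanTanh_betaU {u : ℝ} (hu0 : 0 < u) (hu1 : u < 1) :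
    meanTanh v (betaU (gaussianReal 0 v) u * u) = u := by
  obtain ⟨hα, hmag⟩ := betaU_spec v hu0 hu1
  have hb := (cwAlpha_pos v).trans hα
  set b := betaU (gaussianReal 0 v) u
  have hmax := (cwMag_spec v b).2
  rw [hmag] at hmax
  have hloc := (hmax.isLocalMax (Icc_mem_nhds hu0 hu1)).hasDerivAt_eq_zero (hasDerivAt_cwFun v b u)
  linarith [(mul_eq_zero.1 hloc).resolve_left hb.ne']

/-- Beyond `β_u` the Curie-Weiss function is nondecreasing on `[0, u]`. -/
theorem cwFun_le_of_betaU_lt {u β m : ℝ} (hu0 : 0 < u) (hu1 : u < 1)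
    (hβ : betaU (gaussianReal 0 v) u < β) (hm0 : 0 ≤ m) (hmu : m ≤ u) :
    cwFun (gaussianReal 0 v) m β ≤ cwFun (gaussianReal 0 v) u β := by
  have hb := (cwAlpha_pos v).trans (betaU_spec v hu0 hu1).1
  have hfix := meanTanh_betaU v hu0 hu1
  set b := betaU (gaussianReal 0 v) u
  have hβ0 := hb.trans hβ
  have hmono : MonotoneOn (fun μ => cwFun (gaussianReal 0 v) μ β) (Set.Icc 0 u) := by
    refine monotoneOn_of_deriv_nonneg (convex_Icc _ _) (continuous_cwFun v β).continuousOn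
      (fun x _ => (hasDerivAt_cwFun v β x).differentiableAt.differentiableWithinAt) fun x hx => ?_
    rw [interior_Icc] at hx
    rw [(hasDerivAt_cwFun v β x).deriv]
    refine mul_nonneg hβ0.le (sub_nonneg.2 ?_)
    have h1 := meanTanh_mul_lt v (mul_pos hb hx.1) (mul_lt_mul_of_pos_left hx.2 hb)
    rw [hfix] at h1
    have h2 : 0 < b * u := mul_pos hb hu0
    -- At `β_u` the derivative is already positive on `(0, u)`; raising `β` only increases the
    -- averaged tangent.
    have h3 : meanTanh v (b * x) ≤ meanTanh v (β * x) :=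
      monotone_meanTanh v (mul_le_mul_of_nonneg_right hβ.le hx.1.le)
    nlinarith
  exact hmono ⟨hm0, hmu⟩ ⟨hu0.le, le_rfl⟩ hmu

theorem argmaxSet_gaussianReal_subset {u : ℝ} (hu0 : 0 < u) (hu1 : u < 1) {β : ℝ} {B : ℕ+ → ℝ}
    (hR : (β, B) ∈ regionU (gaussianReal 0 v) u) :
    argmaxSet (gaussianReal 0 v) β B ⊆ Set.Ico (-1) (-u) ∪ Set.Ioc u 1 := by
  obtain ⟨⟨⟨⟨_, hB⟩, _, _⟩, _⟩, hβu, hxi⟩ := hR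
  simp only at hB hβu hxi
  rintro q ⟨⟨hq0, hq1⟩, hmax⟩
  by_contra hq
  have hqu : |q| ≤ u := by
    rw [Set.mem_union, Set.mem_Ico, Set.mem_Ioc, not_or] at hq
    rw [abs_le]
    constructor
    · by_contra h
      exact hq.1 ⟨hq0, not_le.1 h⟩
    · by_contra h
      exact hq.2 ⟨not_le.1 h, hq1⟩
  obtain ⟨⟨hm0, hm1⟩, -⟩ := cwMag_spec v β
  have h1 := (variational_bounds v hB β q).2
  have h2 := (variational_bounds v hB β (cwMag (gaussianReal 0 v) β)).1
  -- The Curie-Weiss magnetization serves as the competitor for the supposed maximizer `q`; the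
  -- sandwich then contradicts `ξ(1) < 2 δ_u(β)`.
  have h3 : variational (gaussianReal 0 v) β B (cwMag (gaussianReal 0 v) β) ≤
      variational (gaussianReal 0 v) β B q := hmax ⟨by linarith, hm1⟩
  have h4 := cwFun_le_of_betaU_lt v hu0 hu1 hβu (abs_nonneg q) hqu
  rw [cwFun_abs] at h4
  rw [deltaU] at hxi
  linarith

end SKFI

theorem theorem5 {S : Type*} [MeasurableSpace S] (P : Measure S) [IsProbabilityMeasure P]
    (h : S → ℝ) (h_gauss : HasGaussianLaw h P) (h_centered : ∫ s, h s ∂P = 0)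
    (h_moment : ∫ s, Real.exp (2 * |h s|) ∂P
      < 1 / sSup ((fun b : ℝ => b / Real.cosh b ^ 2) '' Set.Ici 0))
    (u : ℝ) (hu0 : 0 < u) (hu1 : u < 1)
    (β : ℝ) (B : ℕ+ → ℝ) (hR : (β, B) ∈ SKFI.regionU (P.map h) u) :
    SKFI.argmaxSet (P.map h) β B ⊆ Set.Ico (-1) (-u) ∪ Set.Ioc u 1 := by
  have hlaw := h_gauss.map_eq_gaussianReal
  rw [h_centered] at hlaw
  rw [hlaw] at hR ⊢
  exact SKFI.argmaxSet_gaussianReal_subset _ hu0 hu1 hR
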